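/- Let $n\ge 2$, $p>1$, $-1<a<p-1$ and $s=1-\frac1p-\frac ap$ (so that $0<s<1$). Write $z=(x,t)\in\mathbf{R}^n\times\mathbf{R}=\mathbf{R}^{n+1}$ and $d\mu_a(z)=|t|^a\,dx\,dt$. All balls $B(\cdot,\cdot)$ are open and Euclidean, in the space to which their centre belongs. For a ball $B\subset\mathbf{R}^n$ and a compact set $K\subset B$ let $$\operatorname{cap}_{B^s_p}(K,B)=\inf_v\int_{\mathbf{R}^n}\int_{\mathbf{R}^n}\frac{|v(x)-v(y)|^p}{|x-y|^{n+sp}}\,dx\,dy,$$ and for a ball $B\subset\mathbf{R}^{n+1}$ and a compact set $K\subset B$ let $$\operatorname{cap}_{p,|t|^a}(K,B)=\inf_v\int_B|\nabla v|^p\,d\mu_a,$$ where in both cases the infimum is taken over all $v\in C_0^\infty(B)$ with $v\ge 1$ on $K$. For a Borel set $E\subset B$, each capacity of $E$ relative to $B$ is the supremum of the capacities of the compact subsets $K\subset E$. Then there is a constant $C>0$, depending only on $n$, $p$ and $a$, such that for all $x_0\in\mathbf{R}^n$ and $0<\rho\le r$, with $z_0=(x_0,0)\in\mathbf{R}^{n+1}$,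 $$\operatorname{cap}_{p,|t|^a}\bigl(B(z_0,\tfrac12\rho),B(z_0,2r)\bigr)\le C\operatorname{cap}_{B^s_p}\bigl(\overline{B(x_0,\rho)},B(x_0,2r)\bigr)$$ and $$\operatorname{cap}_{B^s_p}\bigl(\overline{B(x_0,\rho)},B(x_0,2r)\bigr)\le C\operatorname{cap}_{p,|t|^a}\bigl(B(z_0,\rho),B(z_0,2r)\bigr).$$ In particular, for every $0<c\le1$ there is a constant $C'>0$, depending only on $n$, $p$, $s$ and $c$, such that for all $x_0\in\mathbf{R}^n$ and $r>0$, $$\frac{1}{C'}\,r^{n-ps}\le\operatorname{cap}_{B^s_p}\bigl(\overline{B(x_0,cr)},B(x_0,2r)\bigr)\le C'\,r^{n-ps}.$$ -/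

import Mathlib

open MeasureTheory
open scoped ENNReal ContDiff

namespace BesovCap

/-- `v ∈ C₀^∞(B)` and `v ≥ 1` on `K`: the functions that compete in the condenser capacities
of `K` relative to `B`. -/
structure IsAdmissible {E : Type*} [NormedAddCommGroup E] [NormedSpace ℝ E]
    (K B : Set E) (v : E → ℝ) : Prop where
  contDiff : ContDiff ℝ ∞ v
  hasCompactSupport : HasCompactSupport v
  tsupport_subset : tsupport v ⊆ B
  one_le : ∀ x ∈ K, 1 ≤ v x

/-- The Besov seminorm `‖v‖_{B^s_p(ℝⁿ)}`, with values in `[0, ∞]`. -/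
noncomputable def besovSeminorm (n : ℕ) (s p : ℝ) (v : EuclideanSpace ℝ (Fin n) → ℝ) : ℝ≥0∞ :=
  (∫⁻ x, ∫⁻ y, ENNReal.ofReal (|v x - v y| ^ p / ‖x - y‖ ^ ((n : ℝ) + s * p))) ^ (1 / p)

/-- The variational (condenser) Besov capacity of a compact set `K` relative to `B`. -/
noncomputable def besovCapCompact (n : ℕ) (s p : ℝ) (K B : Set (EuclideanSpace ℝ (Fin n))) :
    ℝ≥0∞ :=
  ⨅ (v : EuclideanSpace ℝ (Fin n) → ℝ) (_ : IsAdmissible K B v), besovSeminorm n s p v ^ p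

/-- The Besov capacity of a Borel set `E` relative to `B`: the supremum of the capacities of the
compact subsets of `E`. -/
noncomputable def besovCap (n : ℕ) (s p : ℝ) (E B : Set (EuclideanSpace ℝ (Fin n))) : ℝ≥0∞ :=
  ⨆ (K : Set (EuclideanSpace ℝ (Fin n))) (_ : IsCompact K) (_ : K ⊆ E), besovCapCompact n s p K B

/-- The measure `dμ_a = |t|^a dx dt` on `ℝⁿ⁺¹`; the last coordinate of `z = (x, t)` is `t`. -/
noncomputable def weightMeasure (n : ℕ) (a : ℝ) : Measure (EuclideanSpace ℝ (Fin (n + 1))) :=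
  volume.withDensity fun z => ENNReal.ofReal (|z (Fin.last n)| ^ a)

/-- The weighted variational (condenser) capacity of a compact set `K` relative to `B`. -/
noncomputable def weightedCapCompact (n : ℕ) (p a : ℝ)
    (K B : Set (EuclideanSpace ℝ (Fin (n + 1)))) : ℝ≥0∞ :=
  ⨅ (v : EuclideanSpace ℝ (Fin (n + 1)) → ℝ) (_ : IsAdmissible K B v),
    ∫⁻ z in B, ENNReal.ofReal (‖gradient v z‖ ^ p) ∂(weightMeasure n a)

/-- The weighted capacity of a Borel set `E` relative to `B`: the supremum of the capacities of
the compact subsets of `E`. -/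
noncomputable def weightedCap (n : ℕ) (p a : ℝ) (E B : Set (EuclideanSpace ℝ (Fin (n + 1)))) :
    ℝ≥0∞ :=
  ⨆ (K : Set (EuclideanSpace ℝ (Fin (n + 1)))) (_ : IsCompact K) (_ : K ⊆ E),
    weightedCapCompact n p a K B

/-- The point `(x, 0) ∈ ℝⁿ⁺¹`. -/
noncomputable def lift {n : ℕ} (x : EuclideanSpace ℝ (Fin n)) : EuclideanSpace ℝ (Fin (n + 1)) :=
  WithLp.toLp 2 (Fin.snoc (α := fun _ => ℝ) (fun i => x i) 0)

theorem IsAdmissible.mono {E : Type*} [NormedAddCommGroup E] [NormedSpace ℝ E]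
    {K L B : Set E} {v : E → ℝ} (h : IsAdmissible L B v) (hKL : K ⊆ L) : IsAdmissible K B v :=
  ⟨h.contDiff, h.hasCompactSupport, h.tsupport_subset, fun x hx => h.one_le x (hKL hx)⟩

/-- On compact sets the two definitions of the Besov capacity agree. -/
theorem besovCap_eq_of_isCompact (n : ℕ) (s p : ℝ) {K B : Set (EuclideanSpace ℝ (Fin n))}
    (hK : IsCompact K) : besovCap n s p K B = besovCapCompact n s p K B := by
  refine le_antisymm (iSup_le fun L => iSup_le fun _ => iSup_le fun hLK => ?_) ?_
  · exact le_iInf₂ fun v hv => iInf₂_le v (hv.mono hLK)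
  · exact le_iSup_of_le K (le_iSup_of_le hK (le_iSup_of_le subset_rfl le_rfl))

/-- On compact sets the two definitions of the weighted capacity agree. -/
theorem weightedCap_eq_of_isCompact (n : ℕ) (p a : ℝ)
    {K B : Set (EuclideanSpace ℝ (Fin (n + 1)))} (hK : IsCompact K) :
    weightedCap n p a K B = weightedCapCompact n p a K B := by
  refine le_antisymm (iSup_le fun L => iSup_le fun _ => iSup_le fun hLK => ?_) ?_
  · exact le_iInf₂ fun v hv => iInf₂_le v (hv.mono hLK)
  · exact le_iSup_of_le K (le_iSup_of_le hK (le_iSup_of_le subset_rfl le_rfl))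

end BesovCap

/-!
Throughout `s p = p - 1 - a`. The comparison of the two capacities rests on the fact that the Besov
space on `ℝⁿ` is the trace space, on the hyperplane `t = 0`, of the Sobolev space of `ℝⁿ⁺¹` with
weight `|t|^a`. Each direction turns a competitor for one capacity into a competitor for the other.

* Extension (`exists_extension`). The function `u(x, t) = ∫ φ(y) v(x + t y) dy` is smooth, has trace
  `v`, and after an integration by parts `|∇u(x, t)|` is at most a multiple of
  `|t|⁻¹ ∫_{|y| ≤ 1} |v(x + t y) - v(x)| dy`. Jensen's inequality and Tonelli's theorem bound its
  energy by the Besov seminorm of `v`. At `(x, t)` it depends only on `v` in the ball of radius `|t|`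
  about `x`, so that `u ≥ 1` on `B(z₀, ρ/2)` if `v ≥ 1` on the closed ball of radius `ρ`.
* Trace (`exists_trace_bound`). The points `(x, 0)` and `(x + h, 0)` are joined through
  `(x + h/2, |h|/2)` by two slanted segments. Hölder's inequality with a power weight on a segment,
  translation invariance in `x` and polar coordinates in `h` bound the Besov seminorm of the trace
  by the energy.

Competitors must be supported in the ball of radius `2r`, which is achieved by a cut-off function
that is `1` on the ball of radius `r ≥ ρ` and lives in the ball of radius `3r/2`. It costs only a
constant factor (`exists_cutoff_energy_le`): a horizontal translation of length `6r` leads from any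
point of `B(z₀, 2r)` to a zero of the function, so that Friedrichs' inequality holds. As the
weighted capacity of the open ball `B(z₀, ρ)` sees only its compact subsets, the second inequality
starts from a competitor for the closed ball of radius `ρ/2` and dilates it by the factor `2`; the
larger support is again cut off.

For the two-sided estimate of the Besov capacity, the upper bound follows from the second inequality
and the energy of a cut-off function (`exists_weightedCap_le_rpow`), and the lower bound from the
pairs `(x, y)` with `x` in the smaller ball, where a competitor is at least `1`, and `y` in a ball
of radius `r` on which it vanishes (`exists_rpow_le_besovCap`).
-/

open MeasureTheory
open scoped ENNReal ContDiff

namespace BesovCap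

/-! ### Coordinates, Tonelli's theorem and scaling for the weighted measure -/

/-- The linear embedding `(x, t) ↦ z = (x, t)` of `ℝⁿ × ℝ` into `ℝⁿ⁺¹`. The norm of `ℝⁿ × ℝ` is
the maximum norm, so this is not an isometry. -/
noncomputable def emb (n : ℕ) :
    EuclideanSpace ℝ (Fin n) × ℝ →L[ℝ] EuclideanSpace ℝ (Fin (n + 1)) :=
  LinearMap.toContinuousLinearMap
    { toFun := fun q => WithLp.toLp 2 (Fin.snoc (α := fun _ => ℝ) (fun i => q.1 i) q.2)
      map_add' := by
        intro q q'
        ext i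
        refine Fin.lastCases ?_ (fun i => ?_) i <;> simp
      map_smul' := by
        intro c q
        ext i
        refine Fin.lastCases ?_ (fun i => ?_) i <;> simp }

/-- The horizontal part `x` of `z = (x, t)`. -/
noncomputable def horiz (n : ℕ) :
    EuclideanSpace ℝ (Fin (n + 1)) →L[ℝ] EuclideanSpace ℝ (Fin n) :=
  LinearMap.toContinuousLinearMap
    { toFun := fun z => WithLp.toLp 2 (fun i => z i.castSucc)
      map_add' := by intro q q'; ext i; simp
      map_smul' := by intro c q; ext i; simp }

/-- The vertical coordinate `t` of `z = (x, t)`. -/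
noncomputable def vert (n : ℕ) : EuclideanSpace ℝ (Fin (n + 1)) →L[ℝ] ℝ :=
  EuclideanSpace.proj (Fin.last n)

@[simp] lemma emb_castSucc {n : ℕ} (q : EuclideanSpace ℝ (Fin n) × ℝ) (i : Fin n) :
    emb n q i.castSucc = q.1 i := by simp [emb]

@[simp] lemma emb_last {n : ℕ} (q : EuclideanSpace ℝ (Fin n) × ℝ) :
    emb n q (Fin.last n) = q.2 := by simp [emb]

@[simp] lemma horiz_apply {n : ℕ} (z : EuclideanSpace ℝ (Fin (n + 1))) (i : Fin n) :
    horiz n z i = z i.castSucc := by simp [horiz]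

@[simp] lemma vert_apply {n : ℕ} (z : EuclideanSpace ℝ (Fin (n + 1))) :
    vert n z = z (Fin.last n) := by simp [vert]

@[simp] lemma horiz_emb {n : ℕ} (q : EuclideanSpace ℝ (Fin n) × ℝ) : horiz n (emb n q) = q.1 := by
  ext i; simp

lemma lift_eq_emb {n : ℕ} (x : EuclideanSpace ℝ (Fin n)) : lift x = emb n (x, 0) := rfl

lemma norm_sq_eq_horiz_vert {n : ℕ} (z : EuclideanSpace ℝ (Fin (n + 1))) :
    ‖z‖ ^ 2 = ‖horiz n z‖ ^ 2 + |vert n z| ^ 2 := by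
  rw [EuclideanSpace.norm_sq_eq, EuclideanSpace.norm_sq_eq, Fin.sum_univ_castSucc]
  simp

lemma norm_horiz_le {n : ℕ} (z : EuclideanSpace ℝ (Fin (n + 1))) : ‖horiz n z‖ ≤ ‖z‖ := by
  refine abs_le_of_sq_le_sq' ?_ (norm_nonneg _) |>.2
  nlinarith [norm_sq_eq_horiz_vert z, sq_nonneg |vert n z|]

lemma abs_vert_le {n : ℕ} (z : EuclideanSpace ℝ (Fin (n + 1))) : |vert n z| ≤ ‖z‖ := by
  refine abs_le_of_sq_le_sq' ?_ (norm_nonneg _) |>.2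
  nlinarith [norm_sq_eq_horiz_vert z, sq_nonneg ‖horiz n z‖]

lemma norm_le_horiz_add_vert {n : ℕ} (z : EuclideanSpace ℝ (Fin (n + 1))) :
    ‖z‖ ≤ ‖horiz n z‖ + |vert n z| := by
  refine abs_le_of_sq_le_sq' ?_ (by positivity) |>.2
  nlinarith [norm_sq_eq_horiz_vert z, norm_nonneg (horiz n z), abs_nonneg (vert n z),
    mul_nonneg (norm_nonneg (horiz n z)) (abs_nonneg (vert n z))]

lemma norm_emb_le {n : ℕ} (q : EuclideanSpace ℝ (Fin n) × ℝ) : ‖emb n q‖ ≤ ‖q.1‖ + |q.2| := by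
  simpa using norm_le_horiz_add_vert (emb n q)

/-- Lebesgue measure on `ℝⁿ⁺¹` is the product of the Lebesgue measures on `ℝ` and `ℝⁿ`. -/
lemma measurePreserving_emb (n : ℕ) :
    MeasurePreserving (fun q : ℝ × EuclideanSpace ℝ (Fin n) => emb n (q.2, q.1))
      (volume.prod volume) volume := by
  have h1 : MeasurePreserving
      (Prod.map id (WithLp.ofLp (p := 2)) : ℝ × EuclideanSpace ℝ (Fin n) → ℝ × (Fin n → ℝ))
      (volume.prod volume) (volume.prod volume) :=
    (MeasurePreserving.id volume).prod (PiLp.volume_preserving_ofLp (Fin n))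
  have h2 := (volume_preserving_piFinSuccAbove (fun _ : Fin (n + 1) => ℝ) (Fin.last n)).symm
  have h3 := (PiLp.volume_preserving_toLp (Fin (n + 1))).comp (h2.comp h1)
  have h4 : (fun q : ℝ × EuclideanSpace ℝ (Fin n) => emb n (q.2, q.1)) =
      WithLp.toLp 2 ∘ (MeasurableEquiv.piFinSuccAbove (fun _ => ℝ) (Fin.last n)).symm ∘
        Prod.map id WithLp.ofLp := by
    funext q
    ext i
    refine Fin.lastCases ?_ (fun i => ?_) i
    · simp [MeasurableEquiv.piFinSuccAbove, Fin.insertNthEquiv]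
    · simp [MeasurableEquiv.piFinSuccAbove, Fin.insertNthEquiv]
  rw [h4]
  exact h3

/-- Tonelli's theorem for `μ_a`. -/
lemma lintegral_weightMeasure (n : ℕ) (a : ℝ) {F : EuclideanSpace ℝ (Fin (n + 1)) → ℝ≥0∞}
    (hF : Measurable F) :
    ∫⁻ z, F z ∂(weightMeasure n a) =
      ∫⁻ t : ℝ, ENNReal.ofReal (|t| ^ a) * ∫⁻ x, F (emb n (x, t)) := by
  have hw : Measurable fun z : EuclideanSpace ℝ (Fin (n + 1)) =>
      ENNReal.ofReal (|z (Fin.last n)| ^ a) := by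
    have : Measurable fun z : EuclideanSpace ℝ (Fin (n + 1)) => z (Fin.last n) := by fun_prop
    fun_prop
  have hm : Measurable fun q : ℝ × EuclideanSpace ℝ (Fin n) =>
      ENNReal.ofReal (|q.1| ^ a) * F (emb n (q.2, q.1)) := by fun_prop
  rw [weightMeasure, lintegral_withDensity_eq_lintegral_mul _ hw hF,
    ← (measurePreserving_emb n).lintegral_comp (hw.mul hF)]
  simp only [Pi.mul_apply, emb_last]
  rw [lintegral_prod _ hm.aemeasurable]
  refine lintegral_congr fun t => ?_
  exact lintegral_const_mul (ENNReal.ofReal (|t| ^ a))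
    (by fun_prop : Measurable fun x => F (emb n (x, t)))

/-- Integration of radial functions in polar coordinates. -/
lemma lintegral_fun_norm {E : Type*} [NormedAddCommGroup E] [NormedSpace ℝ E]
    [MeasurableSpace E] [BorelSpace E] [FiniteDimensional ℝ E] [Nontrivial E] (μ : Measure E)
    [μ.IsAddHaarMeasure] {f : ℝ → ℝ≥0∞} (hf : Measurable f) :
    ∫⁻ x, f ‖x‖ ∂μ = Module.finrank ℝ E * μ (Metric.ball 0 1) *
      ∫⁻ y in Set.Ioi (0 : ℝ), ENNReal.ofReal (y ^ (Module.finrank ℝ E - 1)) * f y := by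
  have h0 : ∫⁻ x, f ‖x‖ ∂μ = ∫⁻ x : ({(0)}ᶜ : Set E), f ‖x.1‖ ∂(μ.comap (↑)) := by
    rw [lintegral_subtype_comap (measurableSet_singleton _).compl fun x ↦ f ‖x‖,
      restrict_compl_singleton]
  have h1 := μ.measurePreserving_homeomorphUnitSphereProd.lintegral_comp_emb
      (Homeomorph.measurableEmbedding _) (f ∘ Subtype.val ∘ Prod.snd)
  simp only [Function.comp_def, homeomorphUnitSphereProd_apply_snd_coe] at h1
  have hm : Measurable fun y : Set.Ioi (0 : ℝ) => f y := by fun_prop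
  rw [h0, h1, lintegral_prod _ (by fun_prop)]
  simp only [lintegral_const, Measure.toSphere_apply_univ]
  rw [Measure.volumeIoiPow, lintegral_withDensity_eq_lintegral_mul _ (by fun_prop) hm, mul_comm]
  congr 1
  exact lintegral_subtype_comap measurableSet_Ioi
    fun y : ℝ => ENNReal.ofReal (y ^ (Module.finrank ℝ E - 1)) * f y

lemma lintegral_comp_abs {f : ℝ → ℝ≥0∞} (hf : Measurable f) :
    ∫⁻ t, f |t| = 2 * ∫⁻ t in Set.Ioi (0 : ℝ), f t := by
  have := lintegral_fun_norm (volume : Measure ℝ) hf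
  simpa [Real.norm_eq_abs, one_add_one_eq_two] using this

lemma lintegral_comp_smul {E : Type*} [NormedAddCommGroup E] [NormedSpace ℝ E]
    [MeasurableSpace E] [BorelSpace E] [FiniteDimensional ℝ E] (μ : Measure E)
    [μ.IsAddHaarMeasure] {f : E → ℝ≥0∞} (hf : Measurable f) {c : ℝ} (hc : c ≠ 0) :
    ∫⁻ x, f (c • x) ∂μ = ENNReal.ofReal |(c ^ Module.finrank ℝ E)⁻¹| * ∫⁻ x, f x ∂μ := by
  rw [← lintegral_map hf (measurable_const_smul c), Measure.map_addHaar_smul μ hc,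
    lintegral_smul_measure, smul_eq_mul]

/-- `μ_a` is invariant under horizontal translations. -/
lemma lintegral_weightMeasure_add_horiz (n : ℕ) (a : ℝ)
    {F : EuclideanSpace ℝ (Fin (n + 1)) → ℝ≥0∞} (hF : Measurable F)
    (e : EuclideanSpace ℝ (Fin n)) :
    ∫⁻ z, F (z + emb n (e, 0)) ∂(weightMeasure n a) = ∫⁻ z, F z ∂(weightMeasure n a) := by
  rw [lintegral_weightMeasure n a (by fun_prop), lintegral_weightMeasure n a hF]
  refine lintegral_congr fun t => ?_
  congr 1
  simp only [← map_add, Prod.mk_add_mk, add_zero]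
  exact lintegral_add_right_eq_self (fun x => F (emb n (x, t))) e

/-- `μ_a` is homogeneous of degree `n + 1 + a`. -/
lemma lintegral_weightMeasure_smul (n : ℕ) (a : ℝ)
    {F : EuclideanSpace ℝ (Fin (n + 1)) → ℝ≥0∞} (hF : Measurable F) {c : ℝ} (hc : 0 < c) :
    ∫⁻ z, F (c • z) ∂(weightMeasure n a) =
      ENNReal.ofReal (c ^ (-((n : ℝ) + 1 + a))) * ∫⁻ z, F z ∂(weightMeasure n a) := by
  rw [lintegral_weightMeasure n a (by fun_prop), lintegral_weightMeasure n a hF]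
  set H : ℝ → ℝ≥0∞ := fun t => ENNReal.ofReal (|t| ^ a) * ∫⁻ x, F (emb n (x, t)) with hH
  have hHm : Measurable H := by
    have h1 : Measurable fun t : ℝ => ∫⁻ x, F (emb n (x, t)) :=
      Measurable.lintegral_prod_right' (f := fun q : ℝ × EuclideanSpace ℝ (Fin n) =>
        F (emb n (q.2, q.1))) (by fun_prop)
    fun_prop
  have key : ∀ t : ℝ, ENNReal.ofReal (|t| ^ a) * ∫⁻ x, F (c • emb n (x, t)) =
      ENNReal.ofReal (c ^ (-((n : ℝ) + a))) * H (c • t) := by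
    intro t
    have h1 := lintegral_comp_smul (volume : Measure (EuclideanSpace ℝ (Fin n)))
      (f := fun x => F (emb n (x, c * t))) (by fun_prop) hc.ne'
    simp only [← map_smul, Prod.smul_mk, smul_eq_mul, hH]
    rw [h1, finrank_euclideanSpace_fin, ← mul_assoc, ← mul_assoc,
      ← ENNReal.ofReal_mul (by positivity), ← ENNReal.ofReal_mul (by positivity)]
    congr 2
    rw [abs_mul, abs_of_pos hc, Real.mul_rpow hc.le (abs_nonneg _),
      abs_of_pos (show 0 < (c ^ n)⁻¹ by positivity),
      ← mul_assoc, ← Real.rpow_add hc, neg_add, neg_add_cancel_right, Real.rpow_neg hc.le,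
      Real.rpow_natCast, mul_comm]
  rw [lintegral_congr key, lintegral_const_mul _ (by fun_prop),
    lintegral_comp_smul volume hHm hc.ne', ← mul_assoc, ← ENNReal.ofReal_mul (by positivity)]
  congr 2
  rw [Module.finrank_self, pow_one, abs_of_pos (by positivity), ← Real.rpow_neg_one,
    ← Real.rpow_add hc]
  congr 1
  ring

lemma lintegral_Ioi_rpow {b : ℝ} (hb : b < -1) {c : ℝ} (hc : 0 < c) :
    ∫⁻ t in Set.Ioi c, ENNReal.ofReal (t ^ b) = ENNReal.ofReal (-c ^ (b + 1) / (b + 1)) := by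
  rw [← integral_Ioi_rpow_of_lt hb hc, ofReal_integral_eq_lintegral_ofReal
    (integrableOn_Ioi_rpow_of_lt hb hc)]
  filter_upwards [ae_restrict_mem measurableSet_Ioi] with t ht
  exact Real.rpow_nonneg (hc.trans ht).le _

lemma lintegral_Ioc_rpow_lt_top {b : ℝ} (hb : -1 < b) (c : ℝ) :
    ∫⁻ t in Set.Ioc 0 c, ENNReal.ofReal (t ^ b) < ⊤ := by
  have h : IntegrableOn (fun t : ℝ => t ^ b) (Set.Ioc 0 c) :=
    (intervalIntegral.intervalIntegrable_rpow' hb (a := 0) (b := c)).1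
  rw [← ofReal_integral_eq_lintegral_ofReal h]
  · exact ENNReal.ofReal_lt_top
  filter_upwards [ae_restrict_mem measurableSet_Ioc] with t ht
  exact Real.rpow_nonneg ht.1.le _

lemma weightMeasure_closedBall_lt_top (n : ℕ) {a : ℝ} (ha : -1 < a) (R : ℝ) :
    weightMeasure n a (Metric.closedBall 0 R) < ⊤ := by
  rw [← lintegral_indicator_one measurableSet_closedBall, lintegral_weightMeasure n a
    (measurable_one.indicator measurableSet_closedBall)]
  calc ∫⁻ t : ℝ, ENNReal.ofReal (|t| ^ a) *
        ∫⁻ x, (Metric.closedBall 0 R).indicator (1 : EuclideanSpace ℝ (Fin (n + 1)) → ℝ≥0∞)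
          (emb n (x, t))
    _ ≤ ∫⁻ t : ℝ, (Set.Iic R).indicator (fun t => ENNReal.ofReal (t ^ a)) |t| *
        volume (Metric.closedBall (0 : EuclideanSpace ℝ (Fin n)) R) := by
      refine lintegral_mono fun t => ?_
      by_cases ht : |t| ≤ R
      · rw [Set.indicator_of_mem (Set.mem_Iic.2 ht)]
        gcongr
        rw [← lintegral_indicator_one measurableSet_closedBall]
        refine lintegral_mono fun x => ?_
        by_cases hx : emb n (x, t) ∈ Metric.closedBall 0 R
        · have : x ∈ Metric.closedBall (0 : EuclideanSpace ℝ (Fin n)) R := by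
            have := norm_horiz_le (emb n (x, t))
            simp only [mem_closedBall_zero_iff, horiz_emb] at *
            linarith
          simp [hx, this]
        · simp [hx]
      · have : ∀ x, emb n (x, t) ∉ Metric.closedBall 0 R := by
          intro x hx
          have := abs_vert_le (emb n (x, t))
          simp only [mem_closedBall_zero_iff, vert_apply, emb_last] at *
          linarith
        simp [this]
    _ < ⊤ := by
      have hm : Measurable ((Set.Iic R).indicator (fun t : ℝ => ENNReal.ofReal (t ^ a))) :=
        (by fun_prop : Measurable fun t : ℝ => ENNReal.ofReal (t ^ a)).indicator measurableSet_Iic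
      rw [lintegral_mul_const _ (by fun_prop), lintegral_comp_abs hm,
        setLIntegral_indicator measurableSet_Iic, Set.inter_comm, Set.Ioi_inter_Iic]
      exact ENNReal.mul_lt_top (ENNReal.mul_lt_top (by simp) (lintegral_Ioc_rpow_lt_top ha R))
        measure_closedBall_lt_top

/-- Hölder's inequality in the form in which it is used to estimate averages. -/
lemma rpow_lintegral_mul_le {α : Type*} [MeasurableSpace α] (μ : Measure α) {p q : ℝ}
    (hpq : p.HolderConjugate q) {f g : α → ℝ≥0∞} (hf : AEMeasurable f μ) (hg : AEMeasurable g μ) :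
    (∫⁻ x, f x * g x ∂μ) ^ p ≤ (∫⁻ x, f x ^ q ∂μ) ^ (p / q) * ∫⁻ x, g x ^ p ∂μ := by
  have h := ENNReal.lintegral_mul_le_Lp_mul_Lq μ hpq.symm hf hg
  calc (∫⁻ x, f x * g x ∂μ) ^ p
      ≤ ((∫⁻ x, f x ^ q ∂μ) ^ (1 / q) * (∫⁻ x, g x ^ p ∂μ) ^ (1 / p)) ^ p :=
        ENNReal.rpow_le_rpow h hpq.nonneg
    _ = _ := by
        rw [ENNReal.mul_rpow_of_nonneg _ _ hpq.nonneg, ← ENNReal.rpow_mul, ← ENNReal.rpow_mul,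
          one_div_mul_cancel hpq.ne_zero, ENNReal.rpow_one]
        congr 2
        ring

/-- Jensen's inequality for `t ↦ t ^ p` and a measure that need not be a probability measure. -/
lemma rpow_setLIntegral_le {α : Type*} [MeasurableSpace α] (μ : Measure α) {p : ℝ} (hp : 1 < p)
    {g : α → ℝ≥0∞} (s : Set α) (hg : AEMeasurable g (μ.restrict s)) :
    (∫⁻ x in s, g x ∂μ) ^ p ≤ μ s ^ (p - 1) * ∫⁻ x in s, g x ^ p ∂μ := by
  have hpq := Real.HolderConjugate.conjExponent hp
  have h := rpow_lintegral_mul_le (μ.restrict s) hpq (f := fun _ => 1) (by fun_prop) hg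
  rw [hpq.div_conj_eq_sub_one] at h
  simpa using h

/-! ### Friedrichs' inequality and cut-off functions -/

/-- The weighted Dirichlet energy `∫ |∇u|^p dμ_a` over the whole of `ℝⁿ⁺¹`. -/
noncomputable def energy (n : ℕ) (p a : ℝ) (u : EuclideanSpace ℝ (Fin (n + 1)) → ℝ) : ℝ≥0∞ :=
  ∫⁻ z, ‖fderiv ℝ u z‖ₑ ^ p ∂(weightMeasure n a)

lemma ofReal_norm_gradient_rpow {E : Type*} [NormedAddCommGroup E] [InnerProductSpace ℝ E]
    [CompleteSpace E] {p : ℝ} (hp : 0 ≤ p) (u : E → ℝ) (z : E) :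
    ENNReal.ofReal (‖gradient u z‖ ^ p) = ‖fderiv ℝ u z‖ₑ ^ p := by
  rw [gradient, LinearIsometryEquiv.norm_map, ← ENNReal.ofReal_rpow_of_nonneg (norm_nonneg _) hp,
    ofReal_norm]

lemma measurable_fderiv_rpow {E : Type*} [NormedAddCommGroup E] [NormedSpace ℝ E]
    [MeasurableSpace E] [OpensMeasurableSpace E] {u : E → ℝ} (hu : ContDiff ℝ ∞ u) (p : ℝ) :
    Measurable fun z => ‖fderiv ℝ u z‖ₑ ^ p := by
  have : Continuous fun z => ‖fderiv ℝ u z‖ₑ := (hu.continuous_fderiv (by simp)).enorm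
  fun_prop

/-- If the support of `u` lies in `B`, then integrating over `B` gives the whole energy. -/
lemma setLIntegral_gradient_eq_energy {n : ℕ} {p : ℝ} (hp : 0 < p) (a : ℝ)
    {u : EuclideanSpace ℝ (Fin (n + 1)) → ℝ} {B : Set (EuclideanSpace ℝ (Fin (n + 1)))}
    (hB : MeasurableSet B) (hu : tsupport u ⊆ B) :
    ∫⁻ z in B, ENNReal.ofReal (‖gradient u z‖ ^ p) ∂(weightMeasure n a) = energy n p a u := by
  rw [energy, ← lintegral_indicator hB]
  refine lintegral_congr fun z => ?_
  by_cases hz : z ∈ B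
  · rw [Set.indicator_of_mem hz, ofReal_norm_gradient_rpow hp.le]
  · have : ‖fderiv ℝ u z‖ₑ = 0 := by
      by_contra h
      refine hz (hu (support_fderiv_subset ℝ fun h0 => h ?_))
      rw [← ofReal_norm, h0, norm_zero, ENNReal.ofReal_zero]
    rw [Set.indicator_of_notMem hz, this, ENNReal.zero_rpow_of_pos hp]

/-- The increment of `u` along a segment is at most the integral of the derivative. -/
lemma enorm_sub_le_lintegral_fderiv {E : Type*} [NormedAddCommGroup E] [NormedSpace ℝ E]
    {u : E → ℝ} (hu : ContDiff ℝ ∞ u) (z e : E) :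
    ‖u (z + e) - u z‖ₑ ≤ ∫⁻ τ in Set.Ioc (0 : ℝ) 1, ‖e‖ₑ * ‖fderiv ℝ u (z + τ • e)‖ₑ := by
  have hder : ∀ τ : ℝ, HasDerivAt (fun τ : ℝ => u (z + τ • e)) (fderiv ℝ u (z + τ • e) e) τ := by
    intro τ
    have h1 : HasDerivAt (fun τ : ℝ => z + τ • e) e τ := by
      simpa using ((hasDerivAt_id τ).smul_const e).const_add z
    exact ((hu.differentiable (by simp)) _).hasFDerivAt.comp_hasDerivAt τ h1
  have hcont : Continuous fun τ : ℝ => fderiv ℝ u (z + τ • e) e :=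
    ((hu.continuous_fderiv (by simp)).comp (by fun_prop)).clm_apply continuous_const
  have h := intervalIntegral.integral_eq_sub_of_hasDerivAt (a := 0) (b := 1)
    (fun τ _ => hder τ) (hcont.intervalIntegrable _ _)
  rw [one_smul, zero_smul, add_zero, intervalIntegral.integral_of_le zero_le_one] at h
  rw [← h]
  refine (enorm_integral_le_lintegral_enorm _).trans (lintegral_mono fun τ => ?_)
  rw [mul_comm]
  exact ContinuousLinearMap.le_opENorm _ _

/-- Friedrichs' inequality: if every point of `S` is moved into the zero set of `u` by one fixed
horizontal translation, then the energy of `u` controls the `L^p` norm of `u` on `S`. -/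
lemma setLIntegral_rpow_le_energy {n : ℕ} {p : ℝ} (hp : 1 < p) (a : ℝ)
    {u : EuclideanSpace ℝ (Fin (n + 1)) → ℝ} (hu : ContDiff ℝ ∞ u)
    {S : Set (EuclideanSpace ℝ (Fin (n + 1)))} (hS : MeasurableSet S)
    (e : EuclideanSpace ℝ (Fin n)) (he : ∀ z ∈ S, u (z + emb n (e, 0)) = 0) :
    ∫⁻ z in S, ‖u z‖ₑ ^ p ∂(weightMeasure n a) ≤ ‖emb n (e, 0)‖ₑ ^ p * energy n p a u := by
  have hp0 : 0 ≤ p := by linarith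
  set c := emb n (e, 0) with hc
  have hD : Continuous fun q : EuclideanSpace ℝ (Fin (n + 1)) × ℝ =>
      ‖fderiv ℝ u (q.1 + q.2 • c)‖ₑ :=
    ((hu.continuous_fderiv (by simp)).comp (by fun_prop)).enorm
  have : SFinite (weightMeasure n a) := by unfold weightMeasure; infer_instance
  calc ∫⁻ z in S, ‖u z‖ₑ ^ p ∂(weightMeasure n a)
      ≤ ∫⁻ z in S, (∫⁻ τ in Set.Ioc (0 : ℝ) 1,
          ‖c‖ₑ ^ p * ‖fderiv ℝ u (z + τ • c)‖ₑ ^ p) ∂(weightMeasure n a) := by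
        refine setLIntegral_mono' hS fun z hz => ?_
        have h1 := enorm_sub_le_lintegral_fderiv hu z c
        rw [he z hz, zero_sub, enorm_neg] at h1
        have hm : Measurable fun τ : ℝ => ‖fderiv ℝ u (z + τ • c)‖ₑ :=
          (hD.comp (by fun_prop : Continuous fun τ : ℝ => (z, τ))).measurable
        refine (ENNReal.rpow_le_rpow h1 hp0).trans
          ((rpow_setLIntegral_le volume hp _ (by fun_prop)).trans ?_)
        simp [ENNReal.mul_rpow_of_nonneg _ _ hp0]
    _ ≤ ∫⁻ z, (∫⁻ τ in Set.Ioc (0 : ℝ) 1,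
          ‖c‖ₑ ^ p * ‖fderiv ℝ u (z + τ • c)‖ₑ ^ p) ∂(weightMeasure n a) :=
        setLIntegral_le_lintegral _ _
    _ = ∫⁻ τ in Set.Ioc (0 : ℝ) 1, (∫⁻ z,
          ‖c‖ₑ ^ p * ‖fderiv ℝ u (z + τ • c)‖ₑ ^ p ∂(weightMeasure n a)) :=
        lintegral_lintegral_swap ((hD.measurable.pow_const p).const_mul _).aemeasurable
    _ = ∫⁻ τ in Set.Ioc (0 : ℝ) 1, ‖c‖ₑ ^ p * energy n p a u := by
        refine lintegral_congr fun τ => ?_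
        have h2 : Measurable fun z => ‖fderiv ℝ u (z + τ • c)‖ₑ :=
          (hD.comp (by fun_prop : Continuous fun z => (z, τ))).measurable
        rw [lintegral_const_mul _ (h2.pow_const p), energy]
        congr 1
        have h3 := lintegral_weightMeasure_add_horiz n a (measurable_fderiv_rpow hu p) (τ • e)
        rw [← h3, hc, ← map_smul, Prod.smul_mk, smul_zero]
    _ = _ := by simp

/-- Cut-off functions between the balls of radii `r` and `3r/2`, with gradients of order `1/r`. -/
lemma exists_cutoff (n : ℕ) : ∃ M : ℝ, 0 ≤ M ∧ ∀ (z₀ : EuclideanSpace ℝ (Fin n)) (r : ℝ), 0 < r →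
    ∃ η : EuclideanSpace ℝ (Fin n) → ℝ, ContDiff ℝ ∞ η ∧ (∀ z, ‖η z‖ ≤ 1) ∧
      (∀ z ∈ Metric.closedBall z₀ r, η z = 1) ∧ tsupport η ⊆ Metric.closedBall z₀ (3 / 2 * r) ∧
      ∀ z, ‖fderiv ℝ η z‖ ≤ M / r := by
  let χ : ContDiffBump (0 : EuclideanSpace ℝ (Fin n)) := ⟨1, 3 / 2, by norm_num, by norm_num⟩
  have hχ : ContDiff ℝ ∞ χ := χ.contDiff
  obtain ⟨M, hM⟩ := (hχ.continuous_fderiv (by simp)).bounded_above_of_compact_support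
    (χ.hasCompactSupport.fderiv ℝ)
  refine ⟨M, (norm_nonneg _).trans (hM 0), fun z₀ r hr => ?_⟩
  refine ⟨fun z => χ (r⁻¹ • (z - z₀)), by fun_prop, fun z => ?_, fun z hz => ?_, ?_, fun z => ?_⟩
  · rw [Real.norm_of_nonneg χ.nonneg]
    exact χ.le_one
  · refine χ.one_of_mem_closedBall ?_
    rw [mem_closedBall_zero_iff, norm_smul, norm_inv, Real.norm_of_nonneg hr.le, ← dist_eq_norm]
    have := Metric.mem_closedBall.1 hz
    change _ ≤ (1 : ℝ)
    rwa [inv_mul_le_iff₀ hr, mul_one]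
  · refine closure_minimal (fun z hz => ?_) Metric.isClosed_closedBall
    have h1 : r⁻¹ • (z - z₀) ∈ Function.support χ := hz
    rw [χ.support_eq, mem_ball_zero_iff, norm_smul, norm_inv, Real.norm_of_nonneg hr.le,
      ← dist_eq_norm, inv_mul_lt_iff₀ hr, mul_comm] at h1
    exact Metric.mem_closedBall.2 h1.le
  · have h1 : HasFDerivAt (fun z => r⁻¹ • (z - z₀))
        (r⁻¹ • ContinuousLinearMap.id ℝ (EuclideanSpace ℝ (Fin n))) z :=
      ((hasFDerivAt_id z).sub_const z₀).const_smul r⁻¹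
    have h2 := ((hχ.differentiable (by simp)) (r⁻¹ • (z - z₀))).hasFDerivAt.comp z h1
    have h3 : fderiv ℝ (fun z => χ (r⁻¹ • (z - z₀))) z =
        r⁻¹ • fderiv ℝ χ (r⁻¹ • (z - z₀)) := by
      rw [show (fun z => χ (r⁻¹ • (z - z₀))) = χ ∘ fun z => r⁻¹ • (z - z₀) from rfl, h2.fderiv]
      ext
      simp
    rw [h3, norm_smul, norm_inv, Real.norm_of_nonneg hr.le, div_eq_inv_mul]
    gcongr
    exact hM _

/-- Multiplication by a cut-off function costs only a constant factor in energy, provided that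
Friedrichs' inequality is available. -/
lemma exists_cutoff_energy_le (n : ℕ) {p : ℝ} (hp : 1 < p) (a : ℝ) : ∃ C : ℝ≥0∞, C ≠ ⊤ ∧
    ∀ (z₀ : EuclideanSpace ℝ (Fin (n + 1))) (r : ℝ), 0 < r →
    ∃ η : EuclideanSpace ℝ (Fin (n + 1)) → ℝ, ContDiff ℝ ∞ η ∧
      (∀ z ∈ Metric.closedBall z₀ r, η z = 1) ∧ tsupport η ⊆ Metric.closedBall z₀ (3 / 2 * r) ∧
      (∀ u : EuclideanSpace ℝ (Fin (n + 1)) → ℝ, ContDiff ℝ ∞ u →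
        ∀ e : EuclideanSpace ℝ (Fin n), ‖e‖ ≤ 6 * r →
        (∀ z ∈ Metric.ball z₀ (2 * r), u (z + emb n (e, 0)) = 0) →
        energy n p a (fun z => η z * u z) ≤ C * energy n p a u) ∧
      energy n p a η ≤
        C * ENNReal.ofReal (r ^ (-p)) * weightMeasure n a (Metric.closedBall z₀ (2 * r)) := by
  have hp0 : 0 < p := by linarith
  obtain ⟨M, hM0, hM⟩ := exists_cutoff (n + 1)
  have hC : (2 : ℝ≥0∞) ^ (p - 1) * (1 + ENNReal.ofReal (6 * M) ^ p) ≠ ⊤ := by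
    refine ENNReal.mul_ne_top (ENNReal.rpow_ne_top_of_nonneg (by linarith) (by simp)) ?_
    exact ENNReal.add_ne_top.2
      ⟨by simp, ENNReal.rpow_ne_top_of_nonneg hp0.le ENNReal.ofReal_ne_top⟩
  refine ⟨max (2 ^ (p - 1) * (1 + ENNReal.ofReal (6 * M) ^ p)) (ENNReal.ofReal M ^ p),
    max_ne_top hC (ENNReal.rpow_ne_top_of_nonneg hp0.le ENNReal.ofReal_ne_top),
    fun z₀ r hr => ?_⟩
  obtain ⟨η, hη, hη1, hηone, hηsupp, hηD⟩ := hM z₀ r hr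
  have hball : tsupport η ⊆ Metric.ball z₀ (2 * r) :=
    hηsupp.trans (Metric.closedBall_subset_ball (by linarith))
  have hηD' : ∀ z, ‖fderiv ℝ η z‖ₑ ≤ ENNReal.ofReal (M / r) := fun z => by
    rw [← ofReal_norm]
    exact ENNReal.ofReal_le_ofReal (hηD z)
  refine ⟨η, hη, hηone, hηsupp, fun u hu e he hue => ?_, ?_⟩
  · have hsupp : tsupport (fun z => η z * u z) ⊆ Metric.ball z₀ (2 * r) :=
      (tsupport_mul_subset_left (f := η) (g := u)).trans hball
    rw [← setLIntegral_gradient_eq_energy hp0 a measurableSet_ball hsupp]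
    refine le_trans ?_ (mul_le_mul_left (le_max_left _ _) _)
    have hu1 : Differentiable ℝ u := hu.differentiable (by simp)
    have hη1' : Differentiable ℝ η := hη.differentiable (by simp)
    have hpt : ∀ z, ENNReal.ofReal (‖gradient (fun z => η z * u z) z‖ ^ p) ≤
        2 ^ (p - 1) * (‖fderiv ℝ u z‖ₑ ^ p + ENNReal.ofReal (M / r) ^ p * ‖u z‖ₑ ^ p) := by
      intro z
      rw [ofReal_norm_gradient_rpow hp0.le, fderiv_fun_mul (hη1' z) (hu1 z),
        ← ENNReal.mul_rpow_of_nonneg _ _ hp0.le]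
      refine le_trans (ENNReal.rpow_le_rpow ?_ hp0.le)
        (ENNReal.rpow_add_le_mul_rpow_add_rpow _ _ hp.le)
      rw [← ofReal_norm, ← ofReal_norm, ← ofReal_norm, ← ENNReal.ofReal_mul (by positivity),
        ← ENNReal.ofReal_add (norm_nonneg _) (by positivity)]
      refine ENNReal.ofReal_le_ofReal ((norm_add_le _ _).trans (add_le_add ?_ ?_))
      · rw [norm_smul]
        exact mul_le_of_le_one_left (norm_nonneg _) (hη1 z)
      · rw [norm_smul, mul_comm]
        gcongr
        exact hηD z
    have hum : Measurable (fun z => ‖u z‖ₑ ^ p) := by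
      have := hu.continuous.enorm.measurable
      fun_prop
    calc _ ≤ ∫⁻ z in Metric.ball z₀ (2 * r), 2 ^ (p - 1) *
          (‖fderiv ℝ u z‖ₑ ^ p + ENNReal.ofReal (M / r) ^ p * ‖u z‖ₑ ^ p) ∂(weightMeasure n a) :=
        lintegral_mono hpt
      _ = 2 ^ (p - 1) * (∫⁻ z in Metric.ball z₀ (2 * r), ‖fderiv ℝ u z‖ₑ ^ p ∂(weightMeasure n a)
          + ENNReal.ofReal (M / r) ^ p *
            ∫⁻ z in Metric.ball z₀ (2 * r), ‖u z‖ₑ ^ p ∂(weightMeasure n a)) := by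
        have := measurable_fderiv_rpow hu p
        rw [lintegral_const_mul _ (by fun_prop), lintegral_add_left this,
          lintegral_const_mul _ hum]
      _ ≤ 2 ^ (p - 1) * (energy n p a u + ENNReal.ofReal (M / r) ^ p *
            (ENNReal.ofReal (6 * r) ^ p * energy n p a u)) := by
        gcongr
        · exact setLIntegral_le_lintegral _ _
        · refine (setLIntegral_rpow_le_energy hp a hu measurableSet_ball e hue).trans ?_
          gcongr
          rw [← ofReal_norm]
          refine ENNReal.ofReal_le_ofReal ((norm_emb_le _).trans ?_)
          simpa using he
      _ = _ := by
        have : ENNReal.ofReal (M / r) ^ p * ENNReal.ofReal (6 * r) ^ p =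
            ENNReal.ofReal (6 * M) ^ p := by
          rw [← ENNReal.mul_rpow_of_nonneg _ _ hp0.le, ← ENNReal.ofReal_mul (by positivity)]
          congr 2
          field_simp
        rw [← mul_assoc (ENNReal.ofReal (M / r) ^ p), this]
        ring
  · rw [← setLIntegral_gradient_eq_energy hp0 a measurableSet_closedBall
      (hball.trans Metric.ball_subset_closedBall)]
    calc
      _ ≤ ∫⁻ z in Metric.closedBall z₀ (2 * r), ENNReal.ofReal (M / r) ^ p
          ∂(weightMeasure n a) := by
        refine lintegral_mono fun z => ?_
        rw [ofReal_norm_gradient_rpow hp0.le]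
        exact ENNReal.rpow_le_rpow (hηD' z) hp0.le
      _ = ENNReal.ofReal M ^ p * ENNReal.ofReal (r ^ (-p)) *
          weightMeasure n a (Metric.closedBall z₀ (2 * r)) := by
        rw [setLIntegral_const, div_eq_mul_inv, ENNReal.ofReal_mul hM0,
          ENNReal.mul_rpow_of_nonneg _ _ hp0.le,
          ENNReal.ofReal_rpow_of_nonneg (inv_nonneg.2 hr.le) hp0.le, Real.rpow_neg hr.le,
          Real.inv_rpow hr.le]
      _ ≤ _ := by
        gcongr
        exact le_max_right _ _

/-- The measure of a ball centred on the hyperplane `t = 0`. -/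
lemma weightMeasure_closedBall_lift {n : ℕ} (a : ℝ) (x₀ : EuclideanSpace ℝ (Fin n)) {r : ℝ}
    (hr : 0 < r) (R : ℝ) :
    weightMeasure n a (Metric.closedBall (lift x₀) (r * R)) =
      ENNReal.ofReal (r ^ ((n : ℝ) + 1 + a)) * weightMeasure n a (Metric.closedBall 0 R) := by
  have hm : ∀ (z : EuclideanSpace ℝ (Fin (n + 1))) (s : ℝ), Measurable
      ((Metric.closedBall z s).indicator (1 : EuclideanSpace ℝ (Fin (n + 1)) → ℝ≥0∞)) :=
    fun z s => measurable_one.indicator measurableSet_closedBall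
  have h1 := lintegral_weightMeasure_add_horiz n a (hm (lift x₀) (r * R)) x₀
  have h2 := lintegral_weightMeasure_smul n a (hm 0 R) (inv_pos.2 hr)
  rw [lintegral_indicator_one measurableSet_closedBall] at h1 h2
  rw [← h1, ← lift_eq_emb, Real.inv_rpow hr.le, ← Real.rpow_neg hr.le, neg_neg] at *
  rw [← h2]
  refine lintegral_congr fun z => ?_
  have : z + lift x₀ ∈ Metric.closedBall (lift x₀) (r * R) ↔
      r⁻¹ • z ∈ Metric.closedBall (0 : EuclideanSpace ℝ (Fin (n + 1))) R := by
    rw [mem_closedBall_iff_norm, add_sub_cancel_right, mem_closedBall_zero_iff, norm_smul, norm_inv,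
      Real.norm_of_nonneg hr.le, inv_mul_le_iff₀ hr]
  by_cases h : z + lift x₀ ∈ Metric.closedBall (lift x₀) (r * R)
  · simp [h, this.1 h]
  · simp [h, mt this.2 h]

/-! ### The trace theorem -/

/-- The `p`-th power of the Besov seminorm, written with the increment `h = y - x` as integration
variable. -/
lemma besovSeminorm_rpow (n : ℕ) {s p : ℝ} (hp : 0 < p) (v : EuclideanSpace ℝ (Fin n) → ℝ) :
    besovSeminorm n s p v ^ p =
      ∫⁻ x, ∫⁻ h, ‖v (x + h) - v x‖ₑ ^ p * ENNReal.ofReal (‖h‖ ^ (-((n : ℝ) + s * p))) := by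
  rw [besovSeminorm, ← ENNReal.rpow_mul, one_div_mul_cancel hp.ne', ENNReal.rpow_one]
  refine lintegral_congr fun x => ?_
  rw [← lintegral_add_left_eq_self _ x]
  refine lintegral_congr fun h => ?_
  rw [div_eq_mul_inv, ENNReal.ofReal_mul (by positivity), Real.rpow_neg (norm_nonneg _),
    ← Real.norm_eq_abs, ← ENNReal.ofReal_rpow_of_nonneg (norm_nonneg _) hp.le, ofReal_norm,
    ← enorm_neg, neg_sub, sub_add_cancel_left, norm_neg]

/-- The slanted vector `(h/2, |h|/2)`: the points `(x, 0) + (h/2, |h|/2)` and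
`(x + h, 0) + (-h/2, |h|/2)` agree. -/
noncomputable def slant (n : ℕ) (h : EuclideanSpace ℝ (Fin n)) :
    EuclideanSpace ℝ (Fin (n + 1)) := emb n ((1 / 2 : ℝ) • h, ‖h‖ / 2)

lemma enorm_slant_le {n : ℕ} (h : EuclideanSpace ℝ (Fin n)) : ‖slant n h‖ₑ ≤ ‖h‖ₑ := by
  rw [← ofReal_norm, ← ofReal_norm]
  refine ENNReal.ofReal_le_ofReal ((norm_emb_le _).trans ?_)
  have := norm_nonneg h
  rw [norm_smul, abs_of_nonneg (by positivity), Real.norm_of_nonneg (by norm_num)]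
  linarith

/-- The `p`-th power of the `L^p` norm of `∇W` on the hyperplane at height `t`. -/
noncomputable def sliceEnergy (n : ℕ) (p : ℝ) (W : EuclideanSpace ℝ (Fin (n + 1)) → ℝ) (t : ℝ) :
    ℝ≥0∞ := ∫⁻ x, ‖fderiv ℝ W (emb n (x, t))‖ₑ ^ p

lemma measurable_sliceEnergy {n : ℕ} {p : ℝ} {W : EuclideanSpace ℝ (Fin (n + 1)) → ℝ}
    (hW : ContDiff ℝ ∞ W) : Measurable (sliceEnergy n p W) := by
  have := measurable_fderiv_rpow hW p
  exact Measurable.lintegral_prod_right' (f := fun q : ℝ × EuclideanSpace ℝ (Fin n) =>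
        ‖fderiv ℝ W (emb n (q.2, q.1))‖ₑ ^ p) (by fun_prop)

lemma energy_eq_lintegral_sliceEnergy {n : ℕ} {p : ℝ} (a : ℝ)
    {W : EuclideanSpace ℝ (Fin (n + 1)) → ℝ} (hW : ContDiff ℝ ∞ W) :
    energy n p a W = ∫⁻ t : ℝ, ENNReal.ofReal (|t| ^ a) * sliceEnergy n p W t :=
  lintegral_weightMeasure n a (measurable_fderiv_rpow hW p)

/-- The increment of `W` along slanted segments issuing from the hyperplane `t = 0`, in `L^p`.
Hölder's inequality is applied with the weight `τ ^ b`, which replaces Hardy's inequality. -/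
lemma lintegral_slant_le {n : ℕ} {p q : ℝ} (hpq : p.HolderConjugate q) (b : ℝ)
    {W : EuclideanSpace ℝ (Fin (n + 1)) → ℝ} (hW : ContDiff ℝ ∞ W)
    (h : EuclideanSpace ℝ (Fin n)) :
    ∫⁻ x, ‖W (emb n (x, 0) + slant n h) - W (emb n (x, 0))‖ₑ ^ p ≤
      (∫⁻ τ in Set.Ioc (0 : ℝ) 1, ENNReal.ofReal (τ ^ (-b * q))) ^ (p / q) *
        ∫⁻ τ in Set.Ioc (0 : ℝ) 1, ENNReal.ofReal (τ ^ (b * p)) *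
          (‖h‖ₑ ^ p * sliceEnergy n p W (τ / 2 * ‖h‖)) := by
  have hp0 : 0 ≤ p := hpq.nonneg
  set A := ∫⁻ τ in Set.Ioc (0 : ℝ) 1, ENNReal.ofReal (τ ^ (-b * q)) with hA
  have hF : Measurable fun z => ‖fderiv ℝ W z‖ₑ :=
    (hW.continuous_fderiv (by simp)).enorm.measurable
  have step1 : ∀ x, ‖W (emb n (x, 0) + slant n h) - W (emb n (x, 0))‖ₑ ^ p ≤
      A ^ (p / q) * ∫⁻ τ in Set.Ioc (0 : ℝ) 1, ENNReal.ofReal (τ ^ (b * p)) *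
        (‖h‖ₑ ^ p * ‖fderiv ℝ W (emb n (x, 0) + τ • slant n h)‖ₑ ^ p) := by
    intro x
    have hx : Measurable fun τ : ℝ => ‖fderiv ℝ W (emb n (x, 0) + τ • slant n h)‖ₑ :=
      hF.comp (by fun_prop : Measurable fun τ : ℝ => emb n (x, 0) + τ • slant n h)
    have h1 : ‖W (emb n (x, 0) + slant n h) - W (emb n (x, 0))‖ₑ ≤
        ∫⁻ τ in Set.Ioc (0 : ℝ) 1, ENNReal.ofReal (τ ^ (-b)) * (ENNReal.ofReal (τ ^ b) *
          (‖h‖ₑ * ‖fderiv ℝ W (emb n (x, 0) + τ • slant n h)‖ₑ)) := by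
      refine (enorm_sub_le_lintegral_fderiv hW _ _).trans
        (setLIntegral_mono' measurableSet_Ioc fun τ hτ => ?_)
      rw [← mul_assoc, ← ENNReal.ofReal_mul (Real.rpow_nonneg hτ.1.le _), ← Real.rpow_add hτ.1,
        neg_add_cancel, Real.rpow_zero, ENNReal.ofReal_one, one_mul]
      gcongr
      exact enorm_slant_le h
    refine (ENNReal.rpow_le_rpow h1 hp0).trans
      ((rpow_lintegral_mul_le _ hpq (by fun_prop) (by fun_prop)).trans (le_of_eq ?_))
    congr 1
    · congr 1
      refine setLIntegral_congr_fun measurableSet_Ioc fun τ hτ => ?_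
      rw [ENNReal.ofReal_rpow_of_nonneg (Real.rpow_nonneg hτ.1.le _) hpq.symm.nonneg,
        ← Real.rpow_mul hτ.1.le]
    · refine setLIntegral_congr_fun measurableSet_Ioc fun τ hτ => ?_
      rw [ENNReal.mul_rpow_of_nonneg _ _ hp0, ENNReal.mul_rpow_of_nonneg _ _ hp0,
        ENNReal.ofReal_rpow_of_nonneg (Real.rpow_nonneg hτ.1.le _) hp0, ← Real.rpow_mul hτ.1.le]
  have hm : Measurable fun r : EuclideanSpace ℝ (Fin n) × ℝ => ENNReal.ofReal (r.2 ^ (b * p)) *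
        (‖h‖ₑ ^ p * ‖fderiv ℝ W (emb n (r.1, 0) + r.2 • slant n h)‖ₑ ^ p) := by fun_prop
  refine (lintegral_mono step1).trans (le_of_eq ?_)
  rw [lintegral_const_mul _ hm.lintegral_prod_right', lintegral_lintegral_swap hm.aemeasurable]
  congr 1
  refine lintegral_congr fun τ => ?_
  have hx : Measurable fun x => ‖fderiv ℝ W (emb n (x, 0) + τ • slant n h)‖ₑ :=
      hF.comp (by fun_prop : Measurable fun x => emb n (x, 0) + τ • slant n h)
  dsimp only
  rw [lintegral_const_mul _ (by fun_prop), lintegral_const_mul _ (by fun_prop), sliceEnergy,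
    ← lintegral_add_right_eq_self (fun x => ‖fderiv ℝ W (emb n (x, τ / 2 * ‖h‖))‖ₑ ^ p)
      ((τ / 2) • h)]
  congr 2
  refine lintegral_congr fun x => ?_
  congr 4
  rw [slant, ← map_smul, ← map_add]
  simp only [Prod.smul_mk, Prod.mk_add_mk, zero_add, smul_smul, smul_eq_mul]
  congr 2
  · module
  · ring

lemma lintegral_radial_sliceEnergy_le {n : ℕ} (hn : 0 < n) {p : ℝ} (a : ℝ)
    {W : EuclideanSpace ℝ (Fin (n + 1)) → ℝ} (hW : ContDiff ℝ ∞ W) {c : ℝ} (hc : 0 < c) :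
    ∫⁻ h : EuclideanSpace ℝ (Fin n), ENNReal.ofReal (‖h‖ ^ (a + 1 - n)) *
        sliceEnergy n p W (c * ‖h‖) ≤
      n * volume (Metric.ball (0 : EuclideanSpace ℝ (Fin n)) 1) *
        (ENNReal.ofReal (c ^ (-(a + 1))) * energy n p a W) := by
  have : Nonempty (Fin n) := ⟨⟨0, hn⟩⟩
  have hG := measurable_sliceEnergy (p := p) hW
  have h1 := lintegral_fun_norm (volume : Measure (EuclideanSpace ℝ (Fin n)))
    (f := fun r => ENNReal.ofReal (r ^ (a + 1 - n)) * sliceEnergy n p W (c * r)) (by fun_prop)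
  rw [finrank_euclideanSpace_fin] at h1
  rw [h1]
  gcongr
  have hm : Measurable fun t : ℝ => ENNReal.ofReal (|t| ^ a) * sliceEnergy n p W t := by fun_prop
  have h2 := lintegral_comp_smul (volume : Measure ℝ) hm hc.ne'
  calc ∫⁻ y in Set.Ioi (0 : ℝ), ENNReal.ofReal (y ^ (n - 1)) *
        (ENNReal.ofReal (y ^ (a + 1 - n)) * sliceEnergy n p W (c * y))
      = ∫⁻ y in Set.Ioi (0 : ℝ), ENNReal.ofReal (c ^ (-a)) *
          (ENNReal.ofReal (|c • y| ^ a) * sliceEnergy n p W (c • y)) := by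
        refine setLIntegral_congr_fun measurableSet_Ioi fun y (hy : 0 < y) => ?_
        simp only [smul_eq_mul]
        rw [← mul_assoc, ← mul_assoc, ← ENNReal.ofReal_mul (by positivity),
          ← ENNReal.ofReal_mul (by positivity), abs_of_pos (by positivity),
          Real.mul_rpow hc.le hy.le, ← mul_assoc, ← Real.rpow_add hc, neg_add_cancel,
          Real.rpow_zero, one_mul, ← Real.rpow_natCast, ← Real.rpow_add hy, Nat.cast_sub hn]
        congr 3
        push_cast
        ring
    _ ≤ ∫⁻ y, ENNReal.ofReal (c ^ (-a)) *
          (ENNReal.ofReal (|c • y| ^ a) * sliceEnergy n p W (c • y)) :=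
        setLIntegral_le_lintegral _ _
    _ = _ := by
        rw [lintegral_const_mul _ (by fun_prop), h2, energy_eq_lintegral_sliceEnergy a hW,
          ← mul_assoc, ← ENNReal.ofReal_mul (by positivity), Module.finrank_self, pow_one,
          abs_of_pos (by positivity), ← Real.rpow_neg_one, ← Real.rpow_add hc, neg_add]

/-- The trace theorem: the Besov seminorm of the restriction of `W` to the hyperplane `t = 0` is
controlled by the weighted Dirichlet energy of `W`. -/
lemma exists_trace_bound {n : ℕ} (hn : 0 < n) {p a s : ℝ} (hp : 1 < p)
    (hap : a < p - 1) (hs : s * p = p - 1 - a) :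
    ∃ C : ℝ≥0∞, C ≠ ⊤ ∧ ∀ W : EuclideanSpace ℝ (Fin (n + 1)) → ℝ, ContDiff ℝ ∞ W →
      besovSeminorm n s p (fun x => W (emb n (x, 0))) ^ p ≤ C * energy n p a W := by
  have hp0 : 0 < p := by linarith
  obtain ⟨q, hpq⟩ : ∃ q, p.HolderConjugate q := ⟨_, Real.HolderConjugate.conjExponent hp⟩
  -- `b` is the midpoint of the interval `(a/p, 1/q)` of exponents for which both integrals in `τ`
  -- below converge.
  set b : ℝ := (a + (p - 1)) / (2 * p) with hb
  have hbp : b * p = (a + (p - 1)) / 2 := by rw [hb]; field_simp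
  have hbq : -1 < -b * q := by
    have h1 : b * q < 1 := by
      have h2 := hpq.sub_one_mul_conj
      have h3 : 0 < q := hpq.symm.pos
      have h4 : b * q * p < 1 * p := by
        calc b * q * p = (b * p) * q := by ring
          _ < (p - 1) * q := by
            refine mul_lt_mul_of_pos_right ?_ h3
            rw [hbp]; linarith
          _ = 1 * p := by rw [h2, one_mul]
      exact lt_of_mul_lt_mul_right h4 hp0.le
    linarith
  set A := (∫⁻ τ in Set.Ioc (0 : ℝ) 1, ENNReal.ofReal (τ ^ (-b * q))) ^ (p / q) with hA
  have hAtop : A ≠ ⊤ := ENNReal.rpow_ne_top_of_nonneg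
    (div_nonneg hp0.le hpq.symm.nonneg) (lintegral_Ioc_rpow_lt_top hbq 1).ne
  set V := (n : ℝ≥0∞) * volume (Metric.ball (0 : EuclideanSpace ℝ (Fin n)) 1) with hV
  have hVtop : V ≠ ⊤ := ENNReal.mul_ne_top (by simp) measure_ball_lt_top.ne
  set T := ∫⁻ τ in Set.Ioc (0 : ℝ) 1, ENNReal.ofReal (τ ^ (b * p - (a + 1))) with hT
  have hTtop : T ≠ ⊤ := (lintegral_Ioc_rpow_lt_top (by rw [hbp]; linarith) 1).ne
  refine ⟨2 ^ (p - 1) * 2 * A * (V * ENNReal.ofReal (2 ^ (a + 1)) * T), ?_, fun W hW => ?_⟩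
  · have h2 : (2 : ℝ≥0∞) ^ (p - 1) ≠ ⊤ := ENNReal.rpow_ne_top_of_nonneg (by linarith) (by simp)
    exact ENNReal.mul_ne_top (ENNReal.mul_ne_top (ENNReal.mul_ne_top h2 (by simp)) hAtop)
      (ENNReal.mul_ne_top (ENNReal.mul_ne_top hVtop (by simp)) hTtop)
  have hG := measurable_sliceEnergy (p := p) hW
  have hWm := hW.continuous.measurable
  have hsl : Measurable (slant n) := by unfold slant; fun_prop
  -- the bound for the increments depends on `|h|` only
  set B : EuclideanSpace ℝ (Fin n) → ℝ≥0∞ := fun h => ∫⁻ τ in Set.Ioc (0 : ℝ) 1,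
    ENNReal.ofReal (τ ^ (b * p)) * (‖h‖ₑ ^ p * sliceEnergy n p W (τ / 2 * ‖h‖)) with hB
  have hBm : Measurable fun r : EuclideanSpace ℝ (Fin n) × ℝ =>
      ENNReal.ofReal (r.2 ^ (b * p)) * (‖r.1‖ₑ ^ p * sliceEnergy n p W (r.2 / 2 * ‖r.1‖)) := by
    fun_prop
  have hBm' : Measurable B := hBm.lintegral_prod_right'
  have hBneg : ∀ h, B (-h) = B h := fun h => by simp [hB]
  have htri : ∀ α β γ : ℝ, ‖β - α‖ₑ ≤ ‖γ - α‖ₑ + ‖γ - β‖ₑ := fun α β γ => by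
    rw [← enorm_neg (γ - β), neg_sub, add_comm, ← sub_add_sub_cancel β γ α]
    exact enorm_add_le _ _
  have step1 : ∀ h : EuclideanSpace ℝ (Fin n),
      ∫⁻ x, ‖W (emb n (x + h, 0)) - W (emb n (x, 0))‖ₑ ^ p ≤ 2 ^ (p - 1) * 2 * A * B h := by
    intro h
    have hm : ∀ k, Measurable fun x =>
        ‖W (emb n (x, 0) + slant n k) - W (emb n (x, 0))‖ₑ ^ p := fun k => by fun_prop
    calc ∫⁻ x, ‖W (emb n (x + h, 0)) - W (emb n (x, 0))‖ₑ ^ p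
        ≤ ∫⁻ x, 2 ^ (p - 1) * (‖W (emb n (x, 0) + slant n h) - W (emb n (x, 0))‖ₑ ^ p +
            ‖W (emb n (x + h, 0) + slant n (-h)) - W (emb n (x + h, 0))‖ₑ ^ p) := by
          refine lintegral_mono fun x => ?_
          refine (ENNReal.rpow_le_rpow ?_ hp0.le).trans
            (ENNReal.rpow_add_le_mul_rpow_add_rpow _ _ hp.le)
          have h1 : emb n (x + h, 0) + slant n (-h) = emb n (x, 0) + slant n h := by
            rw [slant, slant, ← map_add, ← map_add, norm_neg]
            simp only [Prod.mk_add_mk]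
            congr 2
            module
          rw [h1]
          exact htri _ _ _
      _ = 2 ^ (p - 1) * ((∫⁻ x, ‖W (emb n (x, 0) + slant n h) - W (emb n (x, 0))‖ₑ ^ p) +
            ∫⁻ x, ‖W (emb n (x, 0) + slant n (-h)) - W (emb n (x, 0))‖ₑ ^ p) := by
          rw [lintegral_const_mul _ (by fun_prop), lintegral_add_left (hm h),
            lintegral_add_right_eq_self
              (fun x => ‖W (emb n (x, 0) + slant n (-h)) - W (emb n (x, 0))‖ₑ ^ p) h]
      _ ≤ 2 ^ (p - 1) * (A * B h + A * B (-h)) := by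
          gcongr
          · exact lintegral_slant_le hpq b hW h
          · exact lintegral_slant_le hpq b hW (-h)
      _ = _ := by rw [hBneg]; ring
  calc besovSeminorm n s p (fun x => W (emb n (x, 0))) ^ p
      = ∫⁻ h, ∫⁻ x, ‖W (emb n (x + h, 0)) - W (emb n (x, 0))‖ₑ ^ p *
          ENNReal.ofReal (‖h‖ ^ (-((n : ℝ) + s * p))) := by
        rw [besovSeminorm_rpow n hp0, lintegral_lintegral_swap]
        exact Measurable.aemeasurable (by fun_prop)
    _ ≤ ∫⁻ h, 2 ^ (p - 1) * 2 * A * (B h * ENNReal.ofReal (‖h‖ ^ (-((n : ℝ) + s * p)))) := by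
        refine lintegral_mono fun h => ?_
        rw [lintegral_mul_const _ (by fun_prop), ← mul_assoc]
        gcongr
        exact step1 h
    _ = 2 ^ (p - 1) * 2 * A * ∫⁻ h, ∫⁻ τ in Set.Ioc (0 : ℝ) 1, ENNReal.ofReal (τ ^ (b * p)) *
          (‖h‖ₑ ^ p * sliceEnergy n p W (τ / 2 * ‖h‖)) *
            ENNReal.ofReal (‖h‖ ^ (-((n : ℝ) + s * p))) := by
        rw [lintegral_const_mul _ (by fun_prop)]
        congr 1
        refine lintegral_congr fun h => ?_
        rw [hB, lintegral_mul_const]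
        exact hBm.comp (by fun_prop : Measurable fun τ : ℝ => (h, τ))
    _ = 2 ^ (p - 1) * 2 * A * ∫⁻ τ in Set.Ioc (0 : ℝ) 1, ∫⁻ h : EuclideanSpace ℝ (Fin n),
          ENNReal.ofReal (τ ^ (b * p)) * (ENNReal.ofReal (‖h‖ ^ (a + 1 - n)) *
            sliceEnergy n p W (τ / 2 * ‖h‖)) := by
        rw [lintegral_lintegral_swap]
        · have : Nonempty (Fin n) := ⟨⟨0, hn⟩⟩
          congr 1
          refine lintegral_congr fun τ => lintegral_congr_ae ?_
          have h0 : ∀ᵐ h : EuclideanSpace ℝ (Fin n), h ≠ 0 := by simp [ae_iff]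
          filter_upwards [h0] with h hh
          have hpos := norm_pos_iff.2 hh
          rw [← ofReal_norm, ENNReal.ofReal_rpow_of_nonneg (norm_nonneg _) hp0.le,
            show a + 1 - (n : ℝ) = p + -((n : ℝ) + s * p) by rw [hs]; ring,
            Real.rpow_add hpos, ENNReal.ofReal_mul (by positivity)]
          ring
        · exact Measurable.aemeasurable (by fun_prop)
    _ ≤ 2 ^ (p - 1) * 2 * A * ∫⁻ τ in Set.Ioc (0 : ℝ) 1,
          V * ENNReal.ofReal (2 ^ (a + 1)) * energy n p a W *
            ENNReal.ofReal (τ ^ (b * p - (a + 1))) := by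
        refine mul_le_mul_right (setLIntegral_mono' measurableSet_Ioc fun τ hτ => ?_) _
        rw [lintegral_const_mul _ (by fun_prop)]
        refine (mul_le_mul_right (lintegral_radial_sliceEnergy_le hn a hW
          (half_pos hτ.1)) _).trans (le_of_eq ?_)
        rw [← hV, div_eq_mul_inv, Real.mul_rpow hτ.1.le (by norm_num),
          Real.inv_rpow (by norm_num : (0 : ℝ) ≤ 2), Real.rpow_neg (by norm_num : (0 : ℝ) ≤ 2),
          inv_inv, sub_eq_add_neg, Real.rpow_add hτ.1,
          ENNReal.ofReal_mul (Real.rpow_nonneg hτ.1.le _),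
          ENNReal.ofReal_mul (Real.rpow_nonneg hτ.1.le _)]
        ring
    _ = _ := by
        rw [lintegral_const_mul _ (by fun_prop), ← hT]
        ring

/-! ### The extension by averages and its gradient -/

/-- The extension `u(x, t) = ∫ φ(y) v(x + t y) dy` of a function `v` on `ℝⁿ` to `ℝⁿ⁺¹`. Unlike the
convolution with the kernel `|t|⁻ⁿ φ(y / |t|)`, to which it is equal for `t ≠ 0` and even `φ`, this
expression is visibly smooth across `t = 0`. -/
noncomputable def extend {n : ℕ} (φ v : EuclideanSpace ℝ (Fin n) → ℝ)
    (z : EuclideanSpace ℝ (Fin (n + 1))) : ℝ :=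
  ∫ y, φ y * v (horiz n z + vert n z • y)

lemma contDiff_extend {n : ℕ} {φ v : EuclideanSpace ℝ (Fin n) → ℝ} (hφ : ContDiff ℝ ∞ φ)
    (hφs : tsupport φ ⊆ Metric.closedBall 0 1) (hv : ContDiff ℝ ∞ v) :
    ContDiff ℝ ∞ (extend φ v) := by
  have h := contDiffOn_convolution_right_with_param (μ := volume) (n := (⊤ : ℕ∞))
    (f := fun _ : EuclideanSpace ℝ (Fin n) => (1 : ℝ)) (ContinuousLinearMap.mul ℝ ℝ)
    (g := fun (z : EuclideanSpace ℝ (Fin (n + 1))) y =>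
      φ (-y) * v (horiz n z + vert n z • (-y))) (s := Set.univ) isOpen_univ
    (isCompact_closedBall (0 : EuclideanSpace ℝ (Fin n)) 1)
    (fun z y _ hy => by
      have : φ (-y) = 0 := by
        by_contra h0
        have := hφs (subset_tsupport φ h0)
        exact hy (by simpa using this)
      simp [this])
    (continuous_const.locallyIntegrable)
    (ContDiff.contDiffOn (by
      simp only [Function.HasUncurry.uncurry, id]
      fun_prop))
  rw [Set.univ_prod_univ, contDiffOn_univ] at h
  have h2 := h.comp (contDiff_id.prodMk (contDiff_const (c := (0 : EuclideanSpace ℝ (Fin n)))))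
  have h3 : extend φ v = (fun q : EuclideanSpace ℝ (Fin (n + 1)) × EuclideanSpace ℝ (Fin n) =>
      convolution (fun _ => (1 : ℝ)) (fun y => φ (-y) * v (horiz n q.1 + vert n q.1 • -y))
        (ContinuousLinearMap.mul ℝ ℝ) volume q.2) ∘ fun z => (id z, 0) := by
    funext z
    simp [extend, convolution]
  rw [h3]
  exact h2

lemma hasFDerivAt_extend {n : ℕ} {φ v : EuclideanSpace ℝ (Fin n) → ℝ} (hφ : Continuous φ)
    (hφs : tsupport φ ⊆ Metric.closedBall 0 1) (hv : ContDiff ℝ ∞ v) (hvs : HasCompactSupport v)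
    (z : EuclideanSpace ℝ (Fin (n + 1))) :
    Integrable (fun y => φ y • (fderiv ℝ v (horiz n z + vert n z • y)).comp
      (horiz n + (vert n).smulRight y)) ∧
    HasFDerivAt (extend φ v) (∫ y, φ y • (fderiv ℝ v (horiz n z + vert n z • y)).comp
      (horiz n + (vert n).smulRight y)) z := by
  have hφc : HasCompactSupport φ := (isCompact_closedBall _ _).of_isClosed_subset
    (isClosed_tsupport _) hφs
  have hvc := hv.continuous
  have hDv : Continuous (fderiv ℝ v) := hv.continuous_fderiv (by simp)
  obtain ⟨K, hK⟩ := hDv.bounded_above_of_compact_support (hvs.fderiv ℝ)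
  have hK0 : 0 ≤ K := (norm_nonneg _).trans (hK 0)
  have hF' : ∀ w : EuclideanSpace ℝ (Fin (n + 1)), Continuous fun y =>
      φ y • (fderiv ℝ v (horiz n w + vert n w • y)).comp (horiz n + (vert n).smulRight y) := by
    intro w
    have h1 : Continuous fun y : EuclideanSpace ℝ (Fin n) => (vert n).smulRight y :=
      (ContinuousLinearMap.smulRightL ℝ _ _ (vert n)).continuous
    exact hφ.smul ((hDv.comp (by fun_prop)).clm_comp (continuous_const.add h1))
  refine ⟨(hF' z).integrable_of_hasCompactSupport hφc.smul_right, ?_⟩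
  refine hasFDerivAt_integral_of_dominated_of_fderiv_le (μ := volume) (s := Set.univ)
    (F := fun z y => φ y * v (horiz n z + vert n z • y))
    (F' := fun w y => φ y • (fderiv ℝ v (horiz n w + vert n w • y)).comp
      (horiz n + (vert n).smulRight y))
    (bound := fun y => ‖φ y‖ * (K * (‖horiz n‖ + ‖vert n‖))) Filter.univ_mem
    (Filter.Eventually.of_forall fun w => ?_) ?_ (hF' z).aestronglyMeasurable
    (Filter.Eventually.of_forall fun y w _ => ?_) ?_ (Filter.Eventually.of_forall fun y w _ => ?_)
  · exact Continuous.aestronglyMeasurable (by fun_prop)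
  · exact Continuous.integrable_of_hasCompactSupport (by fun_prop) hφc.mul_right
  · rw [norm_smul]
    by_cases hy : φ y = 0
    · simp [hy]
    have hy1 : ‖y‖ ≤ 1 := by simpa using hφs (subset_tsupport φ hy)
    gcongr
    refine (ContinuousLinearMap.opNorm_comp_le _ _).trans ?_
    gcongr
    · exact hK _
    · refine (norm_add_le _ _).trans ?_
      gcongr
      rw [ContinuousLinearMap.norm_smulRight_apply]
      exact mul_le_of_le_one_right (norm_nonneg _) hy1
  · exact (hφ.norm.mul continuous_const).integrable_of_hasCompactSupport hφc.norm.mul_right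
  · have h1 : HasFDerivAt (fun w => horiz n w + vert n w • y)
        (horiz n + (vert n).smulRight y) w :=
      (horiz n).hasFDerivAt.add ((vert n).hasFDerivAt.smul_const y)
    have h2 := ((hv.differentiable (by simp)) (horiz n w + vert n w • y)).hasFDerivAt.comp w h1
    exact h2.const_mul (φ y)

/-- Integration by parts moves the derivative from `v` to the kernel, and the constant `v x` may
be subtracted from `v`. -/
lemma enorm_integral_mul_fderiv_le {n : ℕ} {ψ v : EuclideanSpace ℝ (Fin n) → ℝ}
    (hψ : ContDiff ℝ ∞ ψ) (hψs : tsupport ψ ⊆ Metric.closedBall 0 1) {M : ℝ}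
    (hM : ∀ y, ‖fderiv ℝ ψ y‖ ≤ M) (hv : ContDiff ℝ ∞ v) {t : ℝ} (ht : t ≠ 0)
    (x e : EuclideanSpace ℝ (Fin n)) (he : ‖e‖ ≤ 1) :
    ‖∫ y, ψ y * fderiv ℝ v (x + t • y) e‖ₑ ≤
      ENNReal.ofReal (M / |t|) * ∫⁻ y in Metric.closedBall 0 1, ‖v (x + t • y) - v x‖ₑ := by
  have hψc : HasCompactSupport ψ := (isCompact_closedBall _ _).of_isClosed_subset
    (isClosed_tsupport _) hψs
  have hvc := hv.continuous
  have hDv : Continuous (fderiv ℝ v) := hv.continuous_fderiv (by simp)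
  have hDψ : Continuous (fderiv ℝ ψ) := hψ.continuous_fderiv (by simp)
  have hψ0 := hψ.continuous
  set g : EuclideanSpace ℝ (Fin n) → ℝ := fun y => v (x + t • y) - v x with hg
  have hgD : ∀ y, HasFDerivAt g (t • fderiv ℝ v (x + t • y)) y := by
    intro y
    have h1 : HasFDerivAt (fun y : EuclideanSpace ℝ (Fin n) => x + t • y)
        (t • ContinuousLinearMap.id ℝ _) y := ((hasFDerivAt_id y).const_smul t).const_add x
    have h2 := ((hv.differentiable (by simp)) (x + t • y)).hasFDerivAt.comp y h1
    rw [ContinuousLinearMap.comp_smul, ContinuousLinearMap.comp_id] at h2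
    exact h2.sub_const (v x)
  have hgc : Continuous g := by fun_prop
  have hI := integral_mul_fderiv_eq_neg_fderiv_mul_of_integrable (μ := volume) (𝕜 := ℝ)
    (f := ψ) (g := g) (v := e)
    (((hDψ.clm_apply continuous_const).mul hgc).integrable_of_hasCompactSupport
      ((hψc.fderiv_apply ℝ e).mul_right))
    (by
      simp only [(hgD _).fderiv]
      refine Continuous.integrable_of_hasCompactSupport ?_ hψc.mul_right
      exact hψ0.mul (((hDv.comp (by fun_prop)).const_smul t).clm_apply continuous_const))
    ((hψ0.mul hgc).integrable_of_hasCompactSupport hψc.mul_right)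
    (fun y _ => hψ.differentiable (by simp) y) (fun y _ => (hgD y).differentiableAt)
  have hI2 : ∫ y, ψ y * fderiv ℝ v (x + t • y) e = - (t⁻¹ * ∫ y, fderiv ℝ ψ y e * g y) := by
    rw [← mul_neg, ← hI, ← integral_const_mul]
    congr 1
    funext y
    rw [(hgD y).fderiv, smul_apply, smul_eq_mul]
    field_simp
  have hM0 : 0 ≤ M := (norm_nonneg _).trans (hM 0)
  rw [hI2, enorm_neg, enorm_mul, div_eq_inv_mul, ENNReal.ofReal_mul (by positivity), ← abs_inv,
    ← Real.norm_eq_abs, ofReal_norm, mul_assoc]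
  gcongr
  refine (enorm_integral_le_lintegral_enorm _).trans ?_
  rw [← lintegral_const_mul' _ _ ENNReal.ofReal_ne_top,
    ← lintegral_indicator measurableSet_closedBall]
  refine lintegral_mono fun y => ?_
  by_cases hy : y ∈ Metric.closedBall (0 : EuclideanSpace ℝ (Fin n)) 1
  · rw [Set.indicator_of_mem hy, enorm_mul]
    gcongr
    rw [← ofReal_norm]
    refine ENNReal.ofReal_le_ofReal ((ContinuousLinearMap.le_opNorm _ _).trans ?_)
    exact (mul_le_mul (hM y) he (norm_nonneg _) hM0).trans (by simp)
  · have : fderiv ℝ ψ y = 0 := by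
      by_contra h
      exact hy (hψs (support_fderiv_subset ℝ h))
    rw [Set.indicator_of_notMem hy, this]
    simp

lemma eq_sum_smul_single {m : ℕ} (w : EuclideanSpace ℝ (Fin m)) :
    w = ∑ j, w j • EuclideanSpace.single j (1 : ℝ) := by
  ext i
  simp [Finset.sum_apply, Pi.single_apply]

lemma enorm_clm_le_sum {m : ℕ} (T : EuclideanSpace ℝ (Fin m) →L[ℝ] ℝ) :
    ‖T‖ₑ ≤ ∑ j, ‖T (EuclideanSpace.single j 1)‖ₑ := by
  have h : ‖T‖ ≤ ∑ j, ‖T (EuclideanSpace.single j 1)‖ := by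
    refine T.opNorm_le_bound (by positivity) fun w => ?_
    conv_lhs => rw [eq_sum_smul_single w, map_sum]
    rw [Finset.sum_mul]
    refine (norm_sum_le _ _).trans (Finset.sum_le_sum fun j _ => ?_)
    rw [map_smul, norm_smul, mul_comm]
    gcongr
    exact PiLp.norm_apply_le w j
  rw [← ofReal_norm]
  refine (ENNReal.ofReal_le_ofReal h).trans ?_
  rw [ENNReal.ofReal_sum_of_nonneg fun _ _ => norm_nonneg _]
  simp only [ofReal_norm, le_refl]

/-- The gradient of the extension at height `t` is controlled by the mean oscillation of `v` at
scale `|t|`. -/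
lemma exists_enorm_fderiv_extend_le {n : ℕ} {φ : EuclideanSpace ℝ (Fin n) → ℝ}
    (hφ : ContDiff ℝ ∞ φ) (hφs : tsupport φ ⊆ Metric.closedBall 0 1) :
    ∃ M : ℝ, 0 ≤ M ∧ ∀ v : EuclideanSpace ℝ (Fin n) → ℝ, ContDiff ℝ ∞ v → HasCompactSupport v →
      ∀ x (t : ℝ), t ≠ 0 → ‖fderiv ℝ (extend φ v) (emb n (x, t))‖ₑ ≤
        ENNReal.ofReal (M / |t|) *
          ∫⁻ y in Metric.closedBall 0 1, ‖v (x + t • y) - v x‖ₑ := by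
  have hbd : ∀ ψ : EuclideanSpace ℝ (Fin n) → ℝ, ContDiff ℝ ∞ ψ →
      tsupport ψ ⊆ Metric.closedBall 0 1 → ∃ M, ∀ y, ‖fderiv ℝ ψ y‖ ≤ M := fun ψ hψ hψs =>
    (hψ.continuous_fderiv (by simp)).bounded_above_of_compact_support
      (HasCompactSupport.fderiv ℝ ((isCompact_closedBall _ _).of_isClosed_subset
        (isClosed_tsupport _) hψs))
  have hψ : ∀ i, ContDiff ℝ ∞ fun y : EuclideanSpace ℝ (Fin n) => φ y * y i := fun i => by
    have : ContDiff ℝ ∞ fun y : EuclideanSpace ℝ (Fin n) => y i :=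
      (EuclideanSpace.proj (𝕜 := ℝ) i).contDiff
    exact hφ.mul this
  have hψs : ∀ i, tsupport (fun y : EuclideanSpace ℝ (Fin n) => φ y * y i) ⊆
      Metric.closedBall 0 1 := fun i =>
    (tsupport_mul_subset_left (f := φ) (g := fun y : EuclideanSpace ℝ (Fin n) => y i)).trans hφs
  obtain ⟨M₀, hM₀⟩ := hbd φ hφ hφs
  choose M hM using fun i => hbd _ (hψ i) (hψs i)
  have hM0 : ∀ i, 0 ≤ M i := fun i => (norm_nonneg _).trans (hM i 0)
  have hM₀0 : 0 ≤ M₀ := (norm_nonneg _).trans (hM₀ 0)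
  refine ⟨∑ i, (M₀ + M i), Finset.sum_nonneg fun i _ => add_nonneg hM₀0 (hM0 i), ?_⟩
  intro v hv hvs x t ht
  obtain ⟨hint, hder⟩ := hasFDerivAt_extend hφ.continuous hφs hv hvs (emb n (x, t))
  simp only [horiz_emb, vert_apply, emb_last] at hint hder
  set J := ∫⁻ y in Metric.closedBall 0 1, ‖v (x + t • y) - v x‖ₑ with hJ
  have happ : ∀ w, fderiv ℝ (extend φ v) (emb n (x, t)) w =
      ∫ y, φ y * fderiv ℝ v (x + t • y) (horiz n w + vert n w • y) := by
    intro w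
    rw [hder.fderiv, ContinuousLinearMap.integral_apply hint]
    rfl
  refine (enorm_clm_le_sum _).trans ?_
  rw [Fin.sum_univ_castSucc]
  have h1 : ∀ i : Fin n, ‖fderiv ℝ (extend φ v) (emb n (x, t))
      (EuclideanSpace.single i.castSucc 1)‖ₑ ≤ ENNReal.ofReal (M₀ / |t|) * J := by
    intro i
    rw [happ]
    have hh : horiz n (EuclideanSpace.single i.castSucc 1) = EuclideanSpace.single i 1 := by
      ext j; simp
    have hv0 : vert n (EuclideanSpace.single i.castSucc 1) = 0 := by
      simp [(Fin.castSucc_lt_last i).ne']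
    simp only [hh, hv0, zero_smul, add_zero]
    exact enorm_integral_mul_fderiv_le hφ hφs hM₀ hv ht x _ (by simp)
  have h2 : ‖fderiv ℝ (extend φ v) (emb n (x, t)) (EuclideanSpace.single (Fin.last n) 1)‖ₑ ≤
      ∑ i, ENNReal.ofReal (M i / |t|) * J := by
    rw [happ]
    have hh : horiz n (EuclideanSpace.single (Fin.last n) 1) = 0 := by
      ext j; simp [(Fin.castSucc_lt_last j).ne]
    have hv0 : vert n (EuclideanSpace.single (Fin.last n) 1) = 1 := by simp
    simp only [hh, hv0, zero_add, one_smul]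
    have hsum : ∀ y : EuclideanSpace ℝ (Fin n), φ y * fderiv ℝ v (x + t • y) y =
        ∑ i, φ y * y i * fderiv ℝ v (x + t • y) (EuclideanSpace.single i 1) := by
      intro y
      have : fderiv ℝ v (x + t • y) y =
          ∑ i, y i * fderiv ℝ v (x + t • y) (EuclideanSpace.single i 1) := by
        conv_lhs =>
          arg 2
          rw [eq_sum_smul_single y]
        simp only [map_sum, map_smul, smul_eq_mul]
      rw [this, Finset.mul_sum]
      simp only [mul_assoc]
    simp only [hsum]
    rw [integral_finsetSum]
    · refine (enorm_sum_le _ _).trans (Finset.sum_le_sum fun i _ => ?_)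
      exact enorm_integral_mul_fderiv_le (hψ i) (hψs i) (hM i) hv ht x _ (by simp)
    · intro i _
      have hDv : Continuous (fderiv ℝ v) := hv.continuous_fderiv (by simp)
      refine Continuous.integrable_of_hasCompactSupport
        ((hψ i).continuous.mul ((hDv.comp (by fun_prop)).clm_apply continuous_const)) ?_
      exact HasCompactSupport.mul_right ((isCompact_closedBall _ _).of_isClosed_subset
        (isClosed_tsupport _) (hψs i))
  refine (add_le_add (Finset.sum_le_sum fun i _ => h1 i) h2).trans (le_of_eq ?_)
  rw [← Finset.sum_add_distrib, Finset.sum_div, ENNReal.ofReal_sum_of_nonneg, Finset.sum_mul]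
  · refine Finset.sum_congr rfl fun i _ => ?_
    rw [← add_mul, add_div, ENNReal.ofReal_add (by positivity) (div_nonneg (hM0 i) (abs_nonneg t))]
  · exact fun i _ => div_nonneg (add_nonneg hM₀0 (hM0 i)) (abs_nonneg t)

/-! ### The extension theorem -/

lemma lintegral_abs_rpow_indicator {b : ℝ} (hb : b < -1) {c : ℝ} (hc : 0 < c) :
    ∫⁻ t : ℝ, (Set.Ici c).indicator (fun t => ENNReal.ofReal (t ^ b)) |t| =
      2 * ENNReal.ofReal (-c ^ (b + 1) / (b + 1)) := by
  rw [lintegral_comp_abs ((by fun_prop : Measurable fun t : ℝ =>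
      ENNReal.ofReal (t ^ b)).indicator measurableSet_Ici),
    setLIntegral_indicator measurableSet_Ici,
    Set.inter_eq_left.2 (Set.Ici_subset_Ioi.2 hc), setLIntegral_congr Ioi_ae_eq_Ici.symm,
    lintegral_Ioi_rpow hb hc]

/-- The increments of `v` at scale at most `|t|`, integrated over all scales with the weight
`|t| ^ (a - p)`, are controlled by the Besov seminorm. -/
lemma lintegral_increments_le {n : ℕ} (hn : 0 < n) {p a s : ℝ} (hp : 0 < p)
    (hap : a < p - 1) (hs : s * p = p - 1 - a)
    {v : EuclideanSpace ℝ (Fin n) → ℝ} (hv : Continuous v) :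
    ∫⁻ t : ℝ, ENNReal.ofReal (|t| ^ (a - p)) * ∫⁻ x,
        ∫⁻ y in Metric.closedBall (0 : EuclideanSpace ℝ (Fin n)) 1, ‖v (x + t • y) - v x‖ₑ ^ p ≤
      2 * ENNReal.ofReal (1 / (n + s * p)) * besovSeminorm n s p v ^ p := by
  have : Nonempty (Fin n) := ⟨⟨0, hn⟩⟩
  have hκ : 0 < (n : ℝ) + s * p := by rw [hs]; have := n.cast_nonneg (α := ℝ); linarith
  have hvm := hv.measurable
  set b : ℝ := a - p - n with hb
  have hb1 : b + 1 = -((n : ℝ) + s * p) := by rw [hs, hb]; ring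
  obtain ⟨k, hk, hkm⟩ : ∃ k : ℝ → EuclideanSpace ℝ (Fin n) → ℝ≥0∞,
      (∀ t h, k t h = (Set.Ici ‖h‖).indicator (fun t => ENNReal.ofReal (t ^ b)) |t|) ∧
      Measurable fun q : ℝ × EuclideanSpace ℝ (Fin n) => k q.1 q.2 := by
    refine ⟨_, fun t h => rfl, ?_⟩
    have h1 : (fun q : ℝ × EuclideanSpace ℝ (Fin n) =>
        (Set.Ici ‖q.2‖).indicator (fun t => ENNReal.ofReal (t ^ b)) |q.1|) =
        {q : ℝ × EuclideanSpace ℝ (Fin n) | ‖q.2‖ ≤ |q.1|}.indicator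
          fun q => ENNReal.ofReal (|q.1| ^ b) := by
      funext q
      simp [Set.indicator_apply]
    rw [h1]
    exact Measurable.indicator (by fun_prop) (measurableSet_le (by fun_prop) (by fun_prop))
  have h0 : ∀ᵐ t : ℝ, t ≠ 0 := by simp [ae_iff]
  have h0' : ∀ᵐ h : EuclideanSpace ℝ (Fin n), h ≠ 0 := by simp [ae_iff]
  have step : ∀ t : ℝ, t ≠ 0 → ∀ x, ENNReal.ofReal (|t| ^ (a - p)) *
      ∫⁻ y in Metric.closedBall (0 : EuclideanSpace ℝ (Fin n)) 1, ‖v (x + t • y) - v x‖ₑ ^ p =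
      ∫⁻ h : EuclideanSpace ℝ (Fin n),
        k t h * ‖v (x + h) - v x‖ₑ ^ p := by
    intro t ht x
    have hFm : Measurable fun h : EuclideanSpace ℝ (Fin n) =>
        k t h * ‖v (x + h) - v x‖ₑ ^ p :=
      (hkm.comp (by fun_prop : Measurable fun h : EuclideanSpace ℝ (Fin n) => (t, h))).mul
        (by fun_prop)
    have h1 := lintegral_comp_smul volume hFm ht
    have ht' := abs_pos.2 ht
    have hc : ENNReal.ofReal (|t| ^ (n : ℝ)) * ENNReal.ofReal |(t ^ n)⁻¹| = 1 := by
      rw [← ENNReal.ofReal_mul (by positivity), Real.rpow_natCast, abs_inv, abs_pow,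
        mul_inv_cancel₀ (by positivity), ENNReal.ofReal_one]
    rw [finrank_euclideanSpace_fin] at h1
    rw [← one_mul (∫⁻ h, _), ← hc, mul_assoc, ← h1, ← lintegral_const_mul _ (by fun_prop),
      ← lintegral_const_mul' _ _ ENNReal.ofReal_ne_top,
      ← lintegral_indicator measurableSet_closedBall]
    refine lintegral_congr fun y => ?_
    by_cases hy : ‖y‖ ≤ 1
    · have hy1 : y ∈ Metric.closedBall (0 : EuclideanSpace ℝ (Fin n)) 1 := by simpa using hy
      have hy2 : |t| ∈ Set.Ici ‖t • y‖ := by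
        rw [Set.mem_Ici, norm_smul, Real.norm_eq_abs]
        exact mul_le_of_le_one_right ht'.le hy
      rw [Set.indicator_of_mem hy1, hk, Set.indicator_of_mem hy2, ← mul_assoc,
        ← ENNReal.ofReal_mul (by positivity), ← Real.rpow_add ht', hb]
      congr 3
      ring
    · have hy1 : y ∉ Metric.closedBall (0 : EuclideanSpace ℝ (Fin n)) 1 := by simpa using hy
      have hy2 : |t| ∉ Set.Ici ‖t • y‖ := by
        rw [Set.mem_Ici, norm_smul, Real.norm_eq_abs, not_le]
        exact lt_mul_of_one_lt_right ht' (not_le.1 hy)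
      rw [Set.indicator_of_notMem hy1, hk, Set.indicator_of_notMem hy2]
      simp
  have hm3 : Measurable fun q : (ℝ × EuclideanSpace ℝ (Fin n)) × EuclideanSpace ℝ (Fin n) =>
      k q.1.1 q.2 *
        ‖v (q.1.2 + q.2) - v q.1.2‖ₑ ^ p :=
    (hkm.comp (by fun_prop : Measurable fun q : (ℝ × EuclideanSpace ℝ (Fin n)) ×
      EuclideanSpace ℝ (Fin n) => (q.1.1, q.2))).mul (by fun_prop)
  refine le_of_eq ?_
  calc ∫⁻ t : ℝ, ENNReal.ofReal (|t| ^ (a - p)) * ∫⁻ x,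
        ∫⁻ y in Metric.closedBall (0 : EuclideanSpace ℝ (Fin n)) 1, ‖v (x + t • y) - v x‖ₑ ^ p
      = ∫⁻ t : ℝ, ∫⁻ x, ∫⁻ h : EuclideanSpace ℝ (Fin n),
        k t h * ‖v (x + h) - v x‖ₑ ^ p := by
        refine lintegral_congr_ae ?_
        filter_upwards [h0] with t ht
        rw [← lintegral_const_mul' _ _ ENNReal.ofReal_ne_top]
        exact lintegral_congr fun x => step t ht x
    _ = ∫⁻ x, ∫⁻ t : ℝ, ∫⁻ h : EuclideanSpace ℝ (Fin n),
        k t h * ‖v (x + h) - v x‖ₑ ^ p := lintegral_lintegral_swap hm3.lintegral_prod_right'.aemeasurable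
    _ = ∫⁻ x, ∫⁻ h : EuclideanSpace ℝ (Fin n), ∫⁻ t : ℝ,
        k t h * ‖v (x + h) - v x‖ₑ ^ p := by
        refine lintegral_congr fun x => lintegral_lintegral_swap (Measurable.aemeasurable ?_)
        exact hm3.comp (by fun_prop : Measurable fun q : ℝ × EuclideanSpace ℝ (Fin n) =>
          ((q.1, x), q.2))
    _ = ∫⁻ x, ∫⁻ h : EuclideanSpace ℝ (Fin n), 2 * ENNReal.ofReal (1 / (n + s * p)) *
          (‖v (x + h) - v x‖ₑ ^ p * ENNReal.ofReal (‖h‖ ^ (-((n : ℝ) + s * p)))) := by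
        refine lintegral_congr fun x => lintegral_congr_ae ?_
        filter_upwards [h0'] with h hh
        have hh' := norm_pos_iff.2 hh
        have hkt : Measurable fun t => k t h :=
          hkm.comp (by fun_prop : Measurable fun t : ℝ => (t, h))
        rw [lintegral_mul_const _ hkt,
          lintegral_congr fun t => hk t h, lintegral_abs_rpow_indicator (by linarith) hh', hb1, neg_div_neg_eq,
          div_eq_mul_one_div, ENNReal.ofReal_mul (by positivity)]
        ring
    _ = 2 * ENNReal.ofReal (1 / (n + s * p)) * besovSeminorm n s p v ^ p := by
        rw [besovSeminorm_rpow n hp, ← lintegral_const_mul _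
          (Measurable.lintegral_prod_right' (f := fun q : EuclideanSpace ℝ (Fin n) ×
            EuclideanSpace ℝ (Fin n) => ‖v (q.1 + q.2) - v q.1‖ₑ ^ p *
              ENNReal.ofReal (‖q.2‖ ^ (-((n : ℝ) + s * p)))) (by fun_prop))]
        refine lintegral_congr fun x => lintegral_const_mul _ (by fun_prop)

/-- The extension theorem. The weighted Dirichlet energy of the extension `u` is controlled by the
Besov seminorm of `v`. At `(x, t)`, the extension inherits the bound `1 ≤ v` and the vanishing of `v`
from the ball of radius `|t|` about `x`. -/
lemma exists_extension {n : ℕ} (hn : 0 < n) {p a s : ℝ} (hp : 1 < p) (hap : a < p - 1)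
    (hs : s * p = p - 1 - a) :
    ∃ C : ℝ≥0∞, C ≠ ⊤ ∧ ∀ v : EuclideanSpace ℝ (Fin n) → ℝ, ContDiff ℝ ∞ v → HasCompactSupport v →
      ∃ u : EuclideanSpace ℝ (Fin (n + 1)) → ℝ, ContDiff ℝ ∞ u ∧
        energy n p a u ≤ C * besovSeminorm n s p v ^ p ∧
        (∀ z, (∀ y, ‖y‖ ≤ |vert n z| → 1 ≤ v (horiz n z + y)) → 1 ≤ u z) ∧
        ∀ z, (∀ y, ‖y‖ ≤ |vert n z| → v (horiz n z + y) = 0) → u z = 0 := by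
  have hp0 : 0 < p := by linarith
  let χ : ContDiffBump (0 : EuclideanSpace ℝ (Fin n)) := ⟨1 / 2, 1, by norm_num, by norm_num⟩
  set φ : EuclideanSpace ℝ (Fin n) → ℝ := χ.normed volume with hφdef
  have hφ : ContDiff ℝ ∞ φ := χ.contDiff_normed
  have hφs : tsupport φ ⊆ Metric.closedBall 0 1 := (χ.tsupport_normed_eq (μ := volume)).le
  have hφc : HasCompactSupport φ := χ.hasCompactSupport_normed
  have hφ0 : ∀ y, 0 ≤ φ y := χ.nonneg_normed
  have hφ1 : ∫ y, φ y = 1 := χ.integral_normed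
  have hnear : ∀ t : ℝ, ∀ y, φ y ≠ 0 → ‖t • y‖ ≤ |t| := by
    intro t y hy
    have hy1 : ‖y‖ ≤ 1 := by simpa using hφs (subset_tsupport φ hy)
    rw [norm_smul, Real.norm_eq_abs]
    exact mul_le_of_le_one_right (abs_nonneg t) hy1
  obtain ⟨M, hM0, hM⟩ := exists_enorm_fderiv_extend_le hφ hφs
  set V := volume (Metric.closedBall (0 : EuclideanSpace ℝ (Fin n)) 1) with hV
  have hVtop : V ^ (p - 1) ≠ ⊤ :=
    ENNReal.rpow_ne_top_of_nonneg (by linarith) measure_closedBall_lt_top.ne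
  refine ⟨ENNReal.ofReal (M ^ p) * V ^ (p - 1) * (2 * ENNReal.ofReal (1 / (n + s * p))),
    ENNReal.mul_ne_top (ENNReal.mul_ne_top (by simp) hVtop) (ENNReal.mul_ne_top (by simp) (by simp)),
    fun v hv hvs => ⟨extend φ v, contDiff_extend hφ hφs hv, ?_, fun z hz => ?_, fun z hz => ?_⟩⟩
  · have hvm := hv.continuous.measurable
    have h0 : ∀ᵐ t : ℝ, t ≠ 0 := by simp [ae_iff]
    have hm : Measurable fun q : (ℝ × EuclideanSpace ℝ (Fin n)) × EuclideanSpace ℝ (Fin n) =>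
        ‖v (q.1.2 + q.1.1 • q.2) - v q.1.2‖ₑ ^ p := by fun_prop
    rw [energy, lintegral_weightMeasure n a
      (measurable_fderiv_rpow (contDiff_extend hφ hφs hv) p)]
    calc _ ≤ ∫⁻ t : ℝ, ENNReal.ofReal (M ^ p) * V ^ (p - 1) *
          (ENNReal.ofReal (|t| ^ (a - p)) * ∫⁻ x,
            ∫⁻ y in Metric.closedBall 0 1, ‖v (x + t • y) - v x‖ₑ ^ p) := ?_
      _ = ENNReal.ofReal (M ^ p) * V ^ (p - 1) *
          ∫⁻ t : ℝ, ENNReal.ofReal (|t| ^ (a - p)) * ∫⁻ x,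
            ∫⁻ y in Metric.closedBall 0 1, ‖v (x + t • y) - v x‖ₑ ^ p :=
        lintegral_const_mul' _ _ (ENNReal.mul_ne_top (by simp) hVtop)
      _ ≤ _ := by
        rw [mul_assoc _ (2 * ENNReal.ofReal _)]
        exact mul_le_mul_right (lintegral_increments_le hn hp0 hap hs hv.continuous) _
    refine lintegral_mono_ae ?_
    filter_upwards [h0] with t ht
    have ht' := abs_pos.2 ht
    have hcoef : ENNReal.ofReal (M ^ p) * V ^ (p - 1) * ENNReal.ofReal (|t| ^ (a - p)) =
        ENNReal.ofReal (|t| ^ a) * (ENNReal.ofReal (M / |t|) ^ p * V ^ (p - 1)) := by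
      rw [ENNReal.ofReal_rpow_of_nonneg (by positivity) hp0.le, Real.div_rpow hM0 ht'.le,
        Real.rpow_sub ht', mul_right_comm, ← mul_assoc, ← ENNReal.ofReal_mul (by positivity),
        ← ENNReal.ofReal_mul (by positivity)]
      congr 2
      ring
    rw [← mul_assoc, hcoef, mul_assoc]
    refine mul_le_mul_right ?_ _
    rw [← lintegral_const_mul' _ _ (ENNReal.mul_ne_top
      (ENNReal.rpow_ne_top_of_nonneg hp0.le ENNReal.ofReal_ne_top) hVtop)]
    refine lintegral_mono fun x => ?_
    refine (ENNReal.rpow_le_rpow (hM v hv hvs x t ht) hp0.le).trans ?_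
    rw [ENNReal.mul_rpow_of_nonneg _ _ hp0.le, mul_assoc]
    exact mul_le_mul_right (rpow_setLIntegral_le volume hp _ (by fun_prop)) _
  · have hvc := hv.continuous
    rw [extend, ← hφ1]
    refine integral_mono (hφ.continuous.integrable_of_hasCompactSupport hφc)
      (Continuous.integrable_of_hasCompactSupport (by have := hφ.continuous; fun_prop)
        hφc.mul_right) fun y => ?_
    by_cases hy : φ y = 0
    · simp [hy]
    · exact le_mul_of_one_le_right (hφ0 y) (hz _ (hnear _ y hy))
  · rw [extend]
    refine integral_eq_zero_of_ae (Filter.Eventually.of_forall fun y => ?_)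
    by_cases hy : φ y = 0
    · simp [hy]
    · simp only [Pi.zero_apply]
      rw [hz _ (hnear _ y hy), mul_zero]

/-! ### Comparison of the capacities -/

lemma le_mul_iInf_isAdmissible {E : Type*} [NormedAddCommGroup E] [NormedSpace ℝ E] {K B : Set E}
    {f : (E → ℝ) → ℝ≥0∞} {X C : ℝ≥0∞} (h0 : C ≠ 0) (hC : C ≠ ⊤)
    (h : ∀ v, IsAdmissible K B v → X ≤ C * f v) :
    X ≤ C * ⨅ (v : E → ℝ) (_ : IsAdmissible K B v), f v := by
  rw [mul_comm, ← ENNReal.div_le_iff_le_mul (.inl h0) (.inl hC)]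
  refine le_iInf₂ fun v hv => ?_
  rw [ENNReal.div_le_iff_le_mul (.inl h0) (.inl hC), mul_comm]
  exact h v hv

lemma IsAdmissible.eq_zero {E : Type*} [NormedAddCommGroup E] [NormedSpace ℝ E] {K : Set E}
    {v : E → ℝ} {x₀ : E} {R : ℝ} (hv : IsAdmissible K (Metric.ball x₀ R) v) {x : E}
    (hx : R ≤ ‖x - x₀‖) : v x = 0 := by
  by_contra h
  have := mem_ball_iff_norm.1 (hv.tsupport_subset (subset_tsupport v h))
  linarith

/-- The weighted capacity of a ball is at most the energy of any function which is at least `1`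
on the ball and whose support lies well inside the larger ball. -/
lemma weightedCap_le_energy {n : ℕ} {p : ℝ} (hp : 0 < p) (a : ℝ)
    {u : EuclideanSpace ℝ (Fin (n + 1)) → ℝ} (hu : ContDiff ℝ ∞ u)
    {z₀ : EuclideanSpace ℝ (Fin (n + 1))} {r R : ℝ} (hr : 0 < r)
    (hus : tsupport u ⊆ Metric.closedBall z₀ (3 / 2 * r))
    (hu1 : ∀ z ∈ Metric.ball z₀ R, 1 ≤ u z) :
    weightedCap n p a (Metric.ball z₀ R) (Metric.ball z₀ (2 * r)) ≤ energy n p a u := by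
  have hB : tsupport u ⊆ Metric.ball z₀ (2 * r) :=
    hus.trans (Metric.closedBall_subset_ball (by linarith))
  rw [← setLIntegral_gradient_eq_energy hp a measurableSet_ball hB]
  refine iSup_le fun K => iSup_le fun _ => iSup_le fun hKR => iInf₂_le u ⟨hu, ?_, hB, ?_⟩
  · exact (isCompact_closedBall _ _).of_isClosed_subset (isClosed_tsupport _) hus
  · exact fun z hz => hu1 z (hKR hz)

lemma exists_norm_eq {n : ℕ} (hn : 0 < n) {R : ℝ} (hR : 0 ≤ R) :
    ∃ e : EuclideanSpace ℝ (Fin n), ‖e‖ = R :=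
  ⟨EuclideanSpace.single ⟨0, hn⟩ R, by simp [abs_of_nonneg hR]⟩

lemma exists_weightedCap_le_besovCap {n : ℕ} (hn : 0 < n) {p a s : ℝ} (hp : 1 < p)
    (hap : a < p - 1) (hs : s * p = p - 1 - a) : ∃ C : ℝ≥0∞, C ≠ ⊤ ∧
    ∀ (x₀ : EuclideanSpace ℝ (Fin n)) (r ρ : ℝ), 0 < ρ → ρ ≤ r →
      weightedCap n p a (Metric.ball (lift x₀) (ρ / 2)) (Metric.ball (lift x₀) (2 * r)) ≤
        C * besovCap n s p (Metric.closedBall x₀ ρ) (Metric.ball x₀ (2 * r)) := by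
  have hp0 : 0 < p := by linarith
  obtain ⟨C₁, hC₁, hext⟩ := exists_extension hn hp hap hs
  obtain ⟨C₂, hC₂, hcut⟩ := exists_cutoff_energy_le n hp a
  refine ⟨C₂ * C₁ + 1, ENNReal.add_ne_top.2 ⟨ENNReal.mul_ne_top hC₂ hC₁, by simp⟩,
    fun x₀ r ρ hρ hρr => ?_⟩
  have hr : 0 < r := hρ.trans_le hρr
  rw [besovCap_eq_of_isCompact n s p (isCompact_closedBall _ _)]
  refine le_mul_iInf_isAdmissible (by simp)
    (ENNReal.add_ne_top.2 ⟨ENNReal.mul_ne_top hC₂ hC₁, by simp⟩) fun v hv => ?_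
  obtain ⟨u, hu, huE, hu1, hu0⟩ := hext v hv.contDiff hv.hasCompactSupport
  obtain ⟨η, hη, hη1, hηs, hηE, -⟩ := hcut (lift x₀) r hr
  obtain ⟨e, he⟩ := exists_norm_eq hn (show 0 ≤ 6 * r by positivity)
  have hlift : ∀ z R, z ∈ Metric.ball (lift x₀) R → ‖horiz n z - x₀‖ < R ∧ |vert n z| < R := by
    intro z R hz
    rw [mem_ball_iff_norm, lift_eq_emb] at hz
    have h1 := norm_horiz_le (z - emb n (x₀, 0))
    have h2 := abs_vert_le (z - emb n (x₀, 0))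
    rw [map_sub, horiz_emb] at h1
    rw [map_sub, vert_apply (emb n _), emb_last, sub_zero] at h2
    exact ⟨h1.trans_lt hz, h2.trans_lt hz⟩
  have hE := hηE u hu e he.le fun z hz => by
    obtain ⟨h1, h2⟩ := hlift z _ hz
    refine hu0 _ fun y hy => hv.eq_zero ?_
    rw [map_add, vert_apply (emb n _), emb_last, add_zero] at hy
    rw [map_add, horiz_emb]
    have h3 : ‖e‖ ≤ ‖horiz n z + e + y - x₀‖ + ‖horiz n z - x₀‖ + ‖y‖ := by
      calc ‖e‖ = ‖(horiz n z + e + y - x₀) - (horiz n z - x₀) - y‖ := by congr 1; abel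
        _ ≤ _ := (norm_sub_le _ _).trans (by gcongr; exact norm_sub_le _ _)
    linarith
  calc _ ≤ energy n p a fun z => η z * u z := by
        refine weightedCap_le_energy hp0 a (hη.mul hu) hr
          ((tsupport_mul_subset_left (f := η) (g := u)).trans hηs) fun z hz => ?_
        have hz1 : z ∈ Metric.closedBall (lift x₀) r :=
          Metric.closedBall_subset_closedBall (by linarith) (Metric.ball_subset_closedBall hz)
        obtain ⟨h1, h2⟩ := hlift z _ hz
        rw [hη1 z hz1, one_mul]
        refine hu1 z fun y hy => hv.one_le _ ?_
        rw [mem_closedBall_iff_norm, add_sub_right_comm]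
        exact (norm_add_le _ _).trans (by linarith)
    _ ≤ C₂ * (C₁ * besovSeminorm n s p v ^ p) := hE.trans (by gcongr)
    _ ≤ (C₂ * C₁ + 1) * besovSeminorm n s p v ^ p := by
        rw [← mul_assoc]
        gcongr
        exact le_self_add

/-- The energy of a function dilated by the factor `2` about a point of the hyperplane `t = 0`. -/
lemma energy_dilation_le {n : ℕ} {p : ℝ} (hp : 0 < p) (a : ℝ)
    {w : EuclideanSpace ℝ (Fin (n + 1)) → ℝ} (hw : ContDiff ℝ ∞ w)
    (x₀ : EuclideanSpace ℝ (Fin n)) :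
    energy n p a (fun z => w (lift x₀ + (1 / 2 : ℝ) • (z - lift x₀))) ≤
      ENNReal.ofReal ((1 / 2 : ℝ) ^ (-((n : ℝ) + 1 + a))) * energy n p a w := by
  have hG := measurable_fderiv_rpow hw p
  set G := fun z => ‖fderiv ℝ w z‖ₑ ^ p with hGdef
  have h1 := lintegral_weightMeasure_add_horiz n a
    (F := fun z => G (lift x₀ + (1 / 2 : ℝ) • (z - lift x₀))) (by fun_prop) x₀
  have h2 := lintegral_weightMeasure_smul n a
    (F := fun z => G (lift x₀ + z)) (by fun_prop) (c := 1 / 2) (by norm_num)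
  have h3 := lintegral_weightMeasure_add_horiz n a hG x₀
  simp only [← lift_eq_emb, add_sub_cancel_right] at h1
  simp only [← lift_eq_emb, add_comm _ (lift x₀)] at h3
  rw [energy, energy, ← h3, ← h2, h1]
  refine lintegral_mono fun z => ENNReal.rpow_le_rpow ?_ hp.le
  have h4 : HasFDerivAt (fun z => lift x₀ + (1 / 2 : ℝ) • (z - lift x₀))
      ((1 / 2 : ℝ) • ContinuousLinearMap.id ℝ (EuclideanSpace ℝ (Fin (n + 1)))) z :=
    (((hasFDerivAt_id z).sub_const (lift x₀)).const_smul (1 / 2 : ℝ)).const_add (lift x₀)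
  have h5 := ((hw.differentiable (by simp)) (lift x₀ + (1 / 2 : ℝ) • (z - lift x₀))).hasFDerivAt.comp
    z h4
  rw [ContinuousLinearMap.comp_smul, ContinuousLinearMap.comp_id] at h5
  have h6 : fderiv ℝ (fun z => w (lift x₀ + (1 / 2 : ℝ) • (z - lift x₀))) z = _ := h5.fderiv
  rw [h6, ← ofReal_norm, ← ofReal_norm, norm_smul]
  refine ENNReal.ofReal_le_ofReal (mul_le_of_le_one_left (norm_nonneg _) ?_)
  rw [Real.norm_of_nonneg (by norm_num)]
  norm_num

lemma exists_besovCap_le_weightedCap {n : ℕ} (hn : 0 < n) {p a s : ℝ} (hp : 1 < p)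
    (hap : a < p - 1) (hs : s * p = p - 1 - a) : ∃ C : ℝ≥0∞, C ≠ ⊤ ∧
    ∀ (x₀ : EuclideanSpace ℝ (Fin n)) (r ρ : ℝ), 0 < ρ → ρ ≤ r →
      besovCap n s p (Metric.closedBall x₀ ρ) (Metric.ball x₀ (2 * r)) ≤
        C * weightedCap n p a (Metric.ball (lift x₀) ρ) (Metric.ball (lift x₀) (2 * r)) := by
  have hp0 : 0 < p := by linarith
  obtain ⟨C₁, hC₁, htr⟩ := exists_trace_bound hn hp hap hs
  obtain ⟨C₂, hC₂, hcut⟩ := exists_cutoff_energy_le n hp a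
  set D := ENNReal.ofReal ((1 / 2 : ℝ) ^ (-((n : ℝ) + 1 + a))) with hD
  have hCtop : C₁ * (C₂ * D) + 1 ≠ ⊤ := ENNReal.add_ne_top.2
    ⟨ENNReal.mul_ne_top hC₁ (ENNReal.mul_ne_top hC₂ ENNReal.ofReal_ne_top), by simp⟩
  refine ⟨C₁ * (C₂ * D) + 1, hCtop, fun x₀ r ρ hρ hρr => ?_⟩
  have hr : 0 < r := hρ.trans_le hρr
  -- The smaller compact ball `K` lies in the open ball of radius `ρ`; the dilation by the factor
  -- `2` takes it back to the closed ball of radius `ρ`.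
  have hK : weightedCapCompact n p a (Metric.closedBall (lift x₀) (ρ / 2))
      (Metric.ball (lift x₀) (2 * r)) ≤
      weightedCap n p a (Metric.ball (lift x₀) ρ) (Metric.ball (lift x₀) (2 * r)) :=
    le_iSup_of_le _ (le_iSup_of_le (isCompact_closedBall _ _)
      (le_iSup_of_le (Metric.closedBall_subset_ball (by linarith)) le_rfl))
  refine le_trans ?_ (mul_le_mul_right hK _)
  refine le_mul_iInf_isAdmissible (by simp) hCtop fun w hw => ?_
  rw [setLIntegral_gradient_eq_energy hp0 a measurableSet_ball hw.tsupport_subset,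
    besovCap_eq_of_isCompact n s p (isCompact_closedBall _ _)]
  obtain ⟨η, hη, hη1, hηs, hηE, -⟩ := hcut (lift x₀) r hr
  obtain ⟨e, he⟩ := exists_norm_eq hn (show 0 ≤ 6 * r by positivity)
  have hwc := hw.contDiff
  have hu : ContDiff ℝ ∞ fun z => w (lift x₀ + (1 / 2 : ℝ) • (z - lift x₀)) := by fun_prop
  have hE := hηE _ hu e he.le fun z hz => by
    refine hw.eq_zero ?_
    rw [mem_ball_iff_norm] at hz
    rw [add_sub_cancel_left, norm_smul, Real.norm_of_nonneg (by norm_num)]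
    have h1 : ‖e‖ ≤ ‖emb n (e, 0)‖ := by simpa using norm_horiz_le (emb n (e, 0))
    have h2 : ‖emb n (e, 0)‖ ≤ ‖z + emb n (e, 0) - lift x₀‖ + ‖z - lift x₀‖ := by
      calc ‖emb n (e, 0)‖ = ‖(z + emb n (e, 0) - lift x₀) - (z - lift x₀)‖ := by congr 1; abel
        _ ≤ _ := norm_sub_le _ _
    linarith
  set W : EuclideanSpace ℝ (Fin (n + 1)) → ℝ :=
    fun z => η z * w (lift x₀ + (1 / 2 : ℝ) • (z - lift x₀)) with hWdef
  have hW : ContDiff ℝ ∞ W := hη.mul hu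
  have hemb : ∀ x, ‖emb n (x, 0) - lift x₀‖ = ‖x - x₀‖ := by
    intro x
    rw [lift_eq_emb, ← map_sub, Prod.mk_sub_mk, sub_zero]
    refine le_antisymm ?_ ?_
    · simpa using norm_emb_le (x - x₀, (0 : ℝ))
    · simpa using norm_horiz_le (emb n (x - x₀, 0))
  have hvs : tsupport (fun x => W (emb n (x, 0))) ⊆ Metric.closedBall x₀ (3 / 2 * r) := by
    refine closure_minimal (fun x hx => ?_) Metric.isClosed_closedBall
    have h1 := hηs (subset_tsupport η (left_ne_zero_of_mul hx))
    rwa [mem_closedBall_iff_norm, hemb, ← mem_closedBall_iff_norm] at h1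
  have hadm : IsAdmissible (Metric.closedBall x₀ ρ) (Metric.ball x₀ (2 * r))
      fun x => W (emb n (x, 0)) := by
    refine ⟨by fun_prop, (isCompact_closedBall _ _).of_isClosed_subset (isClosed_tsupport _) hvs,
      hvs.trans (Metric.closedBall_subset_ball (by linarith)), fun x hx => ?_⟩
    rw [mem_closedBall_iff_norm] at hx
    have h1 : emb n (x, 0) ∈ Metric.closedBall (lift x₀) r := by
      rw [mem_closedBall_iff_norm, hemb]
      exact hx.trans hρr
    simp only [hWdef]
    rw [hη1 _ h1, one_mul]
    refine hw.one_le _ ?_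
    rw [mem_closedBall_iff_norm, add_sub_cancel_left, norm_smul, hemb,
      Real.norm_of_nonneg (by norm_num)]
    linarith
  calc _ ≤ besovSeminorm n s p (fun x => W (emb n (x, 0))) ^ p := iInf₂_le _ hadm
    _ ≤ C₁ * (C₂ * (D * energy n p a w)) := (htr W hW).trans
        (mul_le_mul_right (hE.trans (mul_le_mul_right (energy_dilation_le hp0 a hwc x₀) _)) _)
    _ ≤ _ := by
        rw [← mul_assoc C₂, ← mul_assoc]
        gcongr
        exact le_self_add

/-- The weighted capacity of a ball centred on the hyperplane `t = 0` has at most the order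
prescribed by scaling. -/
lemma exists_weightedCap_le_rpow {n : ℕ} {p a s : ℝ} (hp : 1 < p) (ha : -1 < a)
    (hs : s * p = p - 1 - a) : ∃ C : ℝ≥0∞, C ≠ ⊤ ∧
    ∀ (x₀ : EuclideanSpace ℝ (Fin n)) (r ρ : ℝ), 0 < r → ρ ≤ r →
      weightedCap n p a (Metric.ball (lift x₀) ρ) (Metric.ball (lift x₀) (2 * r)) ≤
        C * ENNReal.ofReal (r ^ ((n : ℝ) - p * s)) := by
  have hp0 : 0 < p := by linarith
  obtain ⟨C, hC, hcut⟩ := exists_cutoff_energy_le n hp a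
  refine ⟨C * weightMeasure n a (Metric.closedBall 0 2),
    ENNReal.mul_ne_top hC (weightMeasure_closedBall_lt_top n ha 2).ne, fun x₀ r ρ hr hρr => ?_⟩
  obtain ⟨η, hη, hη1, hηs, -, hηE⟩ := hcut (lift x₀) r hr
  refine (weightedCap_le_energy hp0 a hη hr hηs fun z hz => ?_).trans (hηE.trans (le_of_eq ?_))
  · exact (hη1 z (Metric.closedBall_subset_closedBall hρr (Metric.ball_subset_closedBall hz))).ge
  · rw [mul_comm 2 r, weightMeasure_closedBall_lift a x₀ hr 2,
      show (n : ℝ) - p * s = -p + ((n : ℝ) + 1 + a) by rw [mul_comm p, hs]; ring,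
      Real.rpow_add hr (-p), ENNReal.ofReal_mul (by positivity)]
    ring

/-- The lower bound for the Besov capacity of a ball: a competitor is at least `1` on the ball and
vanishes on a ball of radius `r` at distance of order `r`. -/
lemma exists_rpow_le_besovCap {n : ℕ} (hn : 0 < n) {p s c : ℝ} (hp : 0 < p)
    (hs : 0 < (n : ℝ) + s * p) (hc : 0 < c) (hc1 : c ≤ 1) : ∃ D : ℝ, 0 < D ∧
    ∀ (x₀ : EuclideanSpace ℝ (Fin n)) (r : ℝ), 0 < r →
      ENNReal.ofReal (D * r ^ ((n : ℝ) - p * s)) ≤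
        besovCap n s p (Metric.closedBall x₀ (c * r)) (Metric.ball x₀ (2 * r)) := by
  set κ := (n : ℝ) + s * p with hκ
  set θ := (volume (Metric.ball (0 : EuclideanSpace ℝ (Fin n)) 1)).toReal with hθ
  have hθ' : volume (Metric.ball (0 : EuclideanSpace ℝ (Fin n)) 1) = ENNReal.ofReal θ :=
    (ENNReal.ofReal_toReal measure_ball_lt_top.ne).symm
  have hθ0 : 0 < θ :=
    ENNReal.toReal_pos (Metric.measure_ball_pos _ _ one_pos).ne' measure_ball_lt_top.ne
  refine ⟨5 ^ (-κ) * θ * (c ^ n * θ), by positivity, fun x₀ r hr => ?_⟩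
  rw [besovCap_eq_of_isCompact n s p (isCompact_closedBall _ _)]
  refine le_iInf₂ fun v hv => ?_
  rw [besovSeminorm_rpow n hp]
  have : Nonempty (Fin n) := ⟨⟨0, hn⟩⟩
  obtain ⟨e, he⟩ := exists_norm_eq hn (show 0 ≤ 4 * r by positivity)
  calc ENNReal.ofReal (5 ^ (-κ) * θ * (c ^ n * θ) * r ^ ((n : ℝ) - p * s))
      = ∫⁻ _ in Metric.closedBall x₀ (c * r), ∫⁻ _ in Metric.ball e r,
          ENNReal.ofReal ((5 * r) ^ (-κ)) := by
        have hvol1 := Measure.addHaar_closedBall (volume : Measure (EuclideanSpace ℝ (Fin n))) x₀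
          (show 0 ≤ c * r by positivity)
        have hvol2 := Measure.addHaar_ball (volume : Measure (EuclideanSpace ℝ (Fin n))) e hr.le
        rw [finrank_euclideanSpace_fin, hθ', ← ENNReal.ofReal_mul (by positivity)] at hvol1 hvol2
        rw [setLIntegral_const, setLIntegral_const, hvol1, hvol2,
          ← ENNReal.ofReal_mul (by positivity), ← ENNReal.ofReal_mul (by positivity)]
        congr 1
        rw [show (n : ℝ) - p * s = -κ + (n + n) by rw [hκ]; ring, Real.rpow_add hr,
          Real.rpow_add hr, Real.mul_rpow (by norm_num) hr.le, mul_pow, Real.rpow_natCast]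
        ring
    _ ≤ ∫⁻ x in Metric.closedBall x₀ (c * r), ∫⁻ h in Metric.ball e r,
          ‖v (x + h) - v x‖ₑ ^ p * ENNReal.ofReal (‖h‖ ^ (-κ)) := by
        refine setLIntegral_mono' measurableSet_closedBall fun x hx =>
          setLIntegral_mono' measurableSet_ball fun h hh => ?_
        have hvx := hv.one_le x hx
        rw [mem_closedBall_iff_norm] at hx
        rw [mem_ball_iff_norm] at hh
        have hcr : c * r ≤ r := mul_le_of_le_one_left hr.le hc1
        have h1 : ‖e‖ ≤ ‖h‖ + ‖h - e‖ := by
          calc ‖e‖ = ‖h - (h - e)‖ := by congr 1; abel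
            _ ≤ _ := norm_sub_le _ _
        have h2 : ‖h‖ ≤ ‖h - e‖ + ‖e‖ := by
          calc ‖h‖ = ‖(h - e) + e‖ := by congr 1; abel
            _ ≤ _ := norm_add_le _ _
        have h3 : ‖h‖ ≤ ‖x + h - x₀‖ + ‖x - x₀‖ := by
          calc ‖h‖ = ‖(x + h - x₀) - (x - x₀)‖ := by congr 1; abel
            _ ≤ _ := norm_sub_le _ _
        have hh0 : 0 < ‖h‖ := by linarith
        rw [hv.eq_zero (show 2 * r ≤ ‖x + h - x₀‖ by linarith), zero_sub, enorm_neg]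
        have h4 : 1 ≤ ‖v x‖ₑ ^ p := by
          refine ENNReal.one_le_rpow ?_ hp
          rw [← ofReal_norm, ENNReal.one_le_ofReal]
          exact hvx.trans (le_abs_self _)
        refine le_trans ?_ (le_mul_of_one_le_left' h4)
        refine ENNReal.ofReal_le_ofReal ?_
        exact Real.rpow_le_rpow_of_nonpos hh0 (by linarith) (by linarith)
    _ ≤ ∫⁻ x, ∫⁻ h, ‖v (x + h) - v x‖ₑ ^ p * ENNReal.ofReal (‖h‖ ^ (-κ)) :=
        (setLIntegral_le_lintegral _ _).trans
          (lintegral_mono fun x => setLIntegral_le_lintegral _ _)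

end BesovCap

theorem lemma2p4 (n : ℕ) (hn : 2 ≤ n) (p a s : ℝ) (hp : 1 < p) (ha : -1 < a) (hap : a < p - 1)
    (hs : s = 1 - 1 / p - a / p) :
    (∃ C : ℝ, 0 < C ∧ ∀ (x₀ : EuclideanSpace ℝ (Fin n)) (r ρ : ℝ), 0 < ρ → ρ ≤ r →
      BesovCap.weightedCap n p a (Metric.ball (BesovCap.lift x₀) (ρ / 2))
          (Metric.ball (BesovCap.lift x₀) (2 * r)) ≤
        ENNReal.ofReal C *
          BesovCap.besovCap n s p (Metric.closedBall x₀ ρ) (Metric.ball x₀ (2 * r)) ∧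
      BesovCap.besovCap n s p (Metric.closedBall x₀ ρ) (Metric.ball x₀ (2 * r)) ≤
        ENNReal.ofReal C *
          BesovCap.weightedCap n p a (Metric.ball (BesovCap.lift x₀) ρ)
            (Metric.ball (BesovCap.lift x₀) (2 * r))) ∧
    (∀ c : ℝ, 0 < c → c ≤ 1 →
      ∃ C : ℝ, 0 < C ∧ ∀ (x₀ : EuclideanSpace ℝ (Fin n)) (r : ℝ), 0 < r →
        ENNReal.ofReal (C⁻¹ * r ^ ((n : ℝ) - p * s)) ≤
          BesovCap.besovCap n s p (Metric.closedBall x₀ (c * r)) (Metric.ball x₀ (2 * r)) ∧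
        BesovCap.besovCap n s p (Metric.closedBall x₀ (c * r)) (Metric.ball x₀ (2 * r)) ≤
          ENNReal.ofReal (C * r ^ ((n : ℝ) - p * s))) := by
  have hn0 : 0 < n := by omega
  have hsp : s * p = p - 1 - a := by
    rw [hs]
    field_simp
  have hκ : 0 < (n : ℝ) + s * p := by
    have := n.cast_nonneg (α := ℝ)
    linarith
  obtain ⟨C₁, hC₁, h₁⟩ := BesovCap.exists_weightedCap_le_besovCap hn0 hp hap hsp
  obtain ⟨C₂, hC₂, h₂⟩ := BesovCap.exists_besovCap_le_weightedCap hn0 hp hap hsp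
  obtain ⟨C₃, hC₃, h₃⟩ := BesovCap.exists_weightedCap_le_rpow (n := n) hp ha hsp
  refine ⟨⟨max C₁.toReal C₂.toReal + 1, by positivity, fun x₀ r ρ hρ hρr => ⟨?_, ?_⟩⟩,
    fun c hc hc1 => ?_⟩
  · refine (h₁ x₀ r ρ hρ hρr).trans ?_
    gcongr
    rw [ENNReal.le_ofReal_iff_toReal_le hC₁ (by positivity)]
    exact (le_max_left _ _).trans (le_add_of_nonneg_right zero_le_one)
  · refine (h₂ x₀ r ρ hρ hρr).trans ?_
    gcongr
    rw [ENNReal.le_ofReal_iff_toReal_le hC₂ (by positivity)]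
    exact (le_max_right _ _).trans (le_add_of_nonneg_right zero_le_one)
  · obtain ⟨D, hD, h₄⟩ := BesovCap.exists_rpow_le_besovCap hn0 (by linarith) hκ hc hc1
    refine ⟨max D⁻¹ (C₂ * C₃).toReal, lt_max_of_lt_left (inv_pos.2 hD),
      fun x₀ r hr => ⟨le_trans ?_ (h₄ x₀ r hr), ?_⟩⟩
    · gcongr
      exact inv_le_of_inv_le₀ hD (le_max_left _ _)
    · have hcr : c * r ≤ r := mul_le_of_le_one_left hr.le hc1
      calc _ ≤ C₂ * (C₃ * ENNReal.ofReal (r ^ ((n : ℝ) - p * s))) :=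
            (h₂ x₀ r (c * r) (by positivity) hcr).trans
              (mul_le_mul_right (h₃ x₀ r (c * r) hr hcr) _)
        _ = ENNReal.ofReal ((C₂ * C₃).toReal * r ^ ((n : ℝ) - p * s)) := by
            rw [← mul_assoc, ENNReal.ofReal_mul ENNReal.toReal_nonneg,
              ENNReal.ofReal_toReal (ENNReal.mul_ne_top hC₂ hC₃)]
        _ ≤ _ := by
            gcongr
            exact le_max_right _ _
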